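/- Let $n\ge 2$. A domain is a nonempty connected open set $D\subset\mathbb{R}^n$; it is called *Apollonian* if $\mathbb{R}^n\setminus D$ is not contained in a hyperplane (so in particular $D\ne\mathbb{R}^n$). For such $D$ and $x,y\in D$ let $d_D(x)=\operatorname{dist}(x,\partial D)$, and let $$\alpha_D(x,y)=\sup_{a,b}\ \log\frac{|a-x|\,|b-y|}{|a-y|\,|b-x|},$$ where $a,b$ range over the boundary of $D$ in $\mathbb{R}^n\cup\{\infty\}$ and $\frac{|\infty-x|}{|\infty-y|}$ is read as $1$. Let $\ell$ denote Euclidean length, let a single point count as a (degenerate) arc, and put $$\lambda_D(x,y)=\inf_\gamma \ell(\gamma),\qquad k_D(x,y)=\inf_\gamma\int_\gamma\frac{|dz|}{d_D(z)},$$ the infima being over all rectifiable paths $\gamma$ joining $x$ and $y$ in $D$. Let $$\varrho_D(x,y)=\inf_\gamma\operatorname{diam}(\gamma)$$ over all arcs $\gamma$ joining $x$ and $y$ in $D$, and $$j'_D(x,y)=\log\Big(1+\frac{\varrho_D(x,y)}{\min\{d_D(x),d_D(y)\}}\Big).$$ For $c>0$, $D$ is *inner $c$-uniform* if each pair of points $z_1,z_2\in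 D$ can be joined by a rectifiable arc $\gamma$ in $D$ such that $\min\{\ell(\gamma[z_1,z]),\ell(\gamma[z_2,z])\}\le c\,d_D(z)$ for all $z\in\gamma$ and $\ell(\gamma)\le c\,\lambda_D(z_1,z_2)$, where $\gamma[z_i,z]$ is the part of $\gamma$ between $z_i$ and $z$. **Corollary 1.2.** For Apollonian domains $D\subset\mathbb{R}^n$ the following two conditions are quantitatively equivalent: 1. $D$ is $A$-uniform with coefficient $K>0$, that is, $k_D(x,y)\le K\,\alpha_D(x,y)$ for all $x,y\in D$; 2. $D$ is inner $c$-uniform and $j'_D(x,y)\le\mu_5\,\alpha_D(x,y)$ for all $x,y\in D$, with constants $c,\mu_5>0$. That is, for every $K>0$ there are $c,\mu_5>0$ depending only on $K$ and $n$ such that every Apollonian domain in $\mathbb{R}^n$ satisfying (1) with $K$ satisfies (2) with $c,\mu_5$; and for all $c,\mu_5>0$ there is $K>0$ depending only on $c,\mu_5$ and $n$ such that every Apollonian domain in $\mathbb{R}^n$ satisfying (2) with $c,\mu_5$ satisfies (1) with $K$. -/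

import Mathlib

noncomputable section

namespace ApollonianGeom

/-- Euclidean `n`-space with its Euclidean norm. -/
abbrev E (n : ℕ) : Type := EuclideanSpace ℝ (Fin n)

variable {n : ℕ}

/-- The boundary of `D` in the one-point compactification of `ℝⁿ`; it contains `∞` exactly
when `D` is unbounded. -/
def extBoundary (D : Set (E n)) : Set (OnePoint (E n)) :=
  frontier ((fun x : E n => (x : OnePoint (E n))) '' D)

/-- The quotient `|a - x| / |a - y|`, read as `1` for `a = ∞`. -/
def distQuot (a : OnePoint (E n)) (x y : E n) : ℝ :=
  OnePoint.elim a 1 (fun p : E n => dist p x / dist p y)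

/-- The Apollonian distance
`α_D(x, y) = sup_{a, b ∈ ∂D} log ((|a - x| |b - y|) / (|a - y| |b - x|))`. -/
def apollonianDist (D : Set (E n)) (x y : E n) : ℝ :=
  sSup {r : ℝ | ∃ a ∈ extBoundary D, ∃ b ∈ extBoundary D,
    r = Real.log (distQuot a x y * distQuot b y x)}

/-- A domain (nonempty connected open set) is Apollonian when its complement is not contained
in a hyperplane `{z | ⟪v, z⟫ = t}`, `v ≠ 0`. In particular it is then a proper subdomain. -/
structure IsApollonianDomain (D : Set (E n)) : Prop where
  isOpen : IsOpen D
  isConnected : IsConnected D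
  not_subset_hyperplane : ∀ v : E n, v ≠ 0 → ∀ t : ℝ, ¬ Dᶜ ⊆ {z : E n | inner ℝ v z = t}

/-- The Euclidean distance `d_D(x)` from `x` to the boundary of `D`. -/
def bdryDist (D : Set (E n)) (x : E n) : ℝ := Metric.infDist x (frontier D)

/-- The Euclidean length of a path; the path is rectifiable when this is not `⊤`. -/
def pathLength {x y : E n} (γ : Path x y) : ENNReal := eVariationOn γ Set.univ

/-- `γ` is an arc: an injective path, or the degenerate arc consisting of the one point `x`. -/
def IsArc {x y : E n} (γ : Path x y) : Prop :=
  Function.Injective γ ∨ ∀ t, γ t = x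

/-- The inner length metric `λ_D(x, y)`: the infimum of the lengths of the rectifiable paths
from `x` to `y` in `D`. -/
def innerLengthDist (D : Set (E n)) (x y : E n) : ENNReal :=
  sInf {l : ENNReal | ∃ γ : Path x y, Set.range γ ⊆ D ∧ pathLength γ ≠ ⊤ ∧ l = pathLength γ}

/-- The inner diameter metric `ϱ_D(x, y)`: the infimum of the diameters of the arcs
from `x` to `y` in `D`. -/
def innerDiamDist (D : Set (E n)) (x y : E n) : ℝ :=
  sInf {r : ℝ | ∃ γ : Path x y, IsArc γ ∧ Set.range γ ⊆ D ∧ r = Metric.diam (Set.range γ)}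

/-- `D` is inner `c`-uniform: any two points `z₁, z₂` of `D` are joined by a rectifiable arc `γ`
in `D` with `min (ℓ(γ[z₁, z])) (ℓ(γ[z, z₂])) ≤ c d_D(z)` for every `z = γ t` on it, and
`ℓ(γ) ≤ c λ_D(z₁, z₂)`. -/
def IsInnerUniform (D : Set (E n)) (c : ℝ) : Prop :=
  0 < c ∧ ∀ z₁ ∈ D, ∀ z₂ ∈ D, ∃ γ : Path z₁ z₂,
    IsArc γ ∧ Set.range γ ⊆ D ∧ pathLength γ ≠ ⊤ ∧
    (∀ t : unitInterval, min (eVariationOn γ (Set.Iic t)) (eVariationOn γ (Set.Ici t)) ≤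
      ENNReal.ofReal (c * bdryDist D (γ t))) ∧
    pathLength γ ≤ ENNReal.ofReal c * innerLengthDist D z₁ z₂

/-- The line integral `∫_γ w |dz|` along a rectifiable path, computed in its arc length
parametrization. -/
def arcLengthIntegral {x y : E n} (γ : Path x y) (w : E n → ℝ) : ℝ :=
  ∫ u in (0 : ℝ)..(pathLength γ).toReal, w (naturalParameterization γ Set.univ 0 u)

/-- The quasihyperbolic metric `k_D(x, y) = inf_γ ∫_γ |dz| / d_D(z)`, the infimum being over the
rectifiable paths from `x` to `y` in `D`. -/
def quasihyperbolicDist (D : Set (E n)) (x y : E n) : ℝ :=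
  sInf {r : ℝ | ∃ γ : Path x y, Set.range γ ⊆ D ∧ pathLength γ ≠ ⊤ ∧
    r = arcLengthIntegral γ (fun z => 1 / bdryDist D z)}

/-- The metric `j'_D(x, y) = log (1 + ϱ_D(x, y) / min (d_D(x)) (d_D(y)))`. -/
def jPrime (D : Set (E n)) (x y : E n) : ℝ :=
  Real.log (1 + innerDiamDist D x y / min (bdryDist D x) (bdryDist D y))

/-- `D` is `A`-uniform with coefficient `K`: `k_D ≤ K α_D` on `D`. -/
def IsAUniform (D : Set (E n)) (K : ℝ) : Prop :=
  ∀ x ∈ D, ∀ y ∈ D, quasihyperbolicDist D x y ≤ K * apollonianDist D x y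

end ApollonianGeom

end

open Set Filter Topology

namespace ApollonianGeom

/-! ### Distance to the boundary; Lipschitz and arc length curves -/

section

variable {n : ℕ} {D : Set (E n)}

/-! (1) ⇒ (2). Every factor in the supremum defining `α_D` is at most `1 + |x - y| / min d_D`, so
`α_D` is at most twice `j = log (1 + |x - y| / min d_D)`, and A-uniformity gives `k_D ≤ 2K j`. The
argument is then that of Gehring and Osgood. Along a curve that nearly minimizes quasihyperbolic
length, `d_D` is a positive 1-Lipschitz function of arc length, and the integral of `1 / d_D` over
any subarc grows only logarithmically. Hence a subarc whose endpoints have `d_D` within a factor two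
of an upper bound `Δ` for `d_D` on it has length at most `T Δ`. Summing over dyadic levels of `d_D`
gives the cigar condition (`exists_uniform_const`), and this bounds the length by a multiple of `|x
- y|` (`exists_uniform_curve`). `IsLipCurve.exists_arc` replaces the curve by an arc. Inner
uniformity then bounds `ϱ_D` by `c` times the length of any competing curve, so `j'_D ≤ c k_D ≤ c K
α_D`.

(2) ⇒ (1). Integrating `1 / d_D` along an inner uniform arc of length `L` gives `k_D ≤ C log (1 + L
/ min d_D)` (`IsLipWeight.integral_le_log`). Since `L ≤ c λ_D`, it remains to compare `λ_D` with
`ϱ_D`. In an inner uniform domain `λ_D ≤ B ϱ_D` (`exists_lipDist_le_mul_diam`): a set of small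
diameter but large inner length would contain many points far apart in `λ_D`; each can be moved a
short way to the centre of a large ball in `D`, and these centres are too well separated to fit in a
bounded region. Hence `k_D ≤ C' j'_D ≤ C' μ₅ α_D`. -/

theorem bdryDist_le_add (D : Set (E n)) (x y : E n) :
    bdryDist D x ≤ bdryDist D y + dist x y :=
  Metric.infDist_le_infDist_add_dist

theorem abs_bdryDist_sub_le (D : Set (E n)) (x y : E n) :
    |bdryDist D x - bdryDist D y| ≤ dist x y := by
  have h1 := bdryDist_le_add D x y
  have h2 := bdryDist_le_add D y x
  rw [dist_comm y x] at h2
  exact abs_le.2 ⟨by linarith, by linarith⟩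

theorem continuous_bdryDist (D : Set (E n)) : Continuous (bdryDist D) :=
  Metric.continuous_infDist_pt _

theorem bdryDist_nonneg (D : Set (E n)) (x : E n) : 0 ≤ bdryDist D x :=
  Metric.infDist_nonneg

theorem bdryDist_pos (hO : IsOpen D) (hF : (frontier D).Nonempty) {x : E n} (hx : x ∈ D) :
    0 < bdryDist D x := by
  refine (isClosed_frontier.notMem_iff_infDist_pos hF).1 fun h => ?_
  rw [hO.frontier_eq] at h
  exact h.2 hx

/-- The ball is connected and misses the frontier, so it lies in `D` or in the exterior; its centre
decides. -/
theorem ball_bdryDist_subset (hO : IsOpen D) {x : E n} (hx : x ∈ D) :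
    Metric.ball x (bdryDist D x) ⊆ D := by
  rcases (bdryDist_nonneg D x).eq_or_lt with h0 | h0
  · simp [← h0]
  have hpre : IsPreconnected (Metric.ball x (bdryDist D x)) :=
    (convex_ball _ _).isPreconnected
  have hcov : Metric.ball x (bdryDist D x) ⊆ D ∪ (closure D)ᶜ := by
    intro z hz
    by_contra hcon
    simp only [mem_union, mem_compl_iff, not_or, not_not] at hcon
    have hzf : z ∈ frontier D := by rw [hO.frontier_eq]; exact ⟨hcon.2, hcon.1⟩
    have := Metric.infDist_le_dist_of_mem (x := x) hzf
    rw [Metric.mem_ball, dist_comm] at hz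
    exact absurd this (not_le.2 hz)
  rcases isPreconnected_iff_subset_of_disjoint.1 hpre D (closure D)ᶜ hO
    isClosed_closure.isOpen_compl hcov
    (by
      rw [show D ∩ (closure D)ᶜ = ∅ by
        ext z; simp only [mem_inter_iff, mem_compl_iff, mem_empty_iff_false, iff_false, not_and,
          not_not]; exact fun h => subset_closure h]
      simp) with h | h
  · exact h
  · exact absurd (subset_closure hx) (h (Metric.mem_ball_self h0))

theorem IsApollonianDomain.frontier_nonempty (hn : 2 ≤ n) (hD : IsApollonianDomain D) :
    (frontier D).Nonempty := by
  refine nonempty_frontier_iff.2 ⟨hD.isConnected.nonempty, fun h => ?_⟩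
  refine hD.not_subset_hyperplane (EuclideanSpace.single ⟨0, by omega⟩ 1) ?_ 0 ?_
  · simp
  · simp [h]

/-- A curve of length at most `L` from `x` to `y` in `D`, as a `1`-Lipschitz map on `[0, L]`. -/
structure IsLipCurve (D : Set (E n)) (x y : E n) (L : ℝ) (g : ℝ → E n) : Prop where
  nonneg : 0 ≤ L
  lip : ∀ s ∈ Icc 0 L, ∀ t ∈ Icc 0 L, dist (g s) (g t) ≤ |s - t|
  left : g 0 = x
  right : g L = y
  mem : ∀ u ∈ Icc 0 L, g u ∈ D

/-- A curve of length `L` from `x` to `y` in `D`, parametrized by arc length on `[0, L]`. -/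
structure IsUnitCurve (D : Set (E n)) (x y : E n) (L : ℝ) (g : ℝ → E n) : Prop where
  nonneg : 0 ≤ L
  var : ∀ s ∈ Icc 0 L, ∀ t ∈ Icc 0 L, s ≤ t → eVariationOn g (Icc s t) = ENNReal.ofReal (t - s)
  left : g 0 = x
  right : g L = y
  mem : ∀ u ∈ Icc 0 L, g u ∈ D

theorem eVariationOn_Icc_le_of_lip {g : ℝ → E n} {s t : ℝ}
    (h : ∀ u ∈ Icc s t, ∀ v ∈ Icc s t, dist (g u) (g v) ≤ |u - v|) :
    eVariationOn g (Icc s t) ≤ ENNReal.ofReal (t - s) := by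
  have hL : LipschitzOnWith 1 g (Icc s t) :=
    LipschitzOnWith.of_dist_le_mul fun u hu v hv => by
      simpa [Real.dist_eq] using h u hu v hv
  have := hL.comp_eVariationOn_le (f := g) (g := id) (s := Icc s t) (fun x hx => hx)
  simpa [eVariationOn_id_Icc] using this

namespace IsLipCurve

variable {x y z : E n} {L M : ℝ} {g h : ℝ → E n}

theorem continuousOn (hg : IsLipCurve D x y L g) : ContinuousOn g (Icc 0 L) := by
  have hL : LipschitzOnWith 1 g (Icc 0 L) :=
    LipschitzOnWith.of_dist_le_mul fun u hu v hv => by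
      simpa [Real.dist_eq] using hg.lip u hu v hv
  exact hL.continuousOn

theorem dist_le (hg : IsLipCurve D x y L g) : dist x y ≤ L := by
  have := hg.lip 0 ⟨le_rfl, hg.nonneg⟩ L ⟨hg.nonneg, le_rfl⟩
  rw [hg.left, hg.right] at this
  simpa [abs_of_nonneg hg.nonneg] using this

theorem reverse (hg : IsLipCurve D x y L g) : IsLipCurve D y x L (fun u => g (L - u)) where
  nonneg := hg.nonneg
  lip s hs t ht := by
    have := hg.lip (L - s) ⟨by linarith [hs.2], by linarith [hs.1]⟩ (L - t)
      ⟨by linarith [ht.2], by linarith [ht.1]⟩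
    rwa [show L - s - (L - t) = -(s - t) by ring, abs_neg] at this
  left := by simp [hg.right]
  right := by simp [hg.left]
  mem u hu := hg.mem _ ⟨by linarith [hu.2], by linarith [hu.1]⟩

theorem restrict (hg : IsLipCurve D x y L g) {s t : ℝ} (hs : 0 ≤ s) (hst : s ≤ t) (ht : t ≤ L) :
    IsLipCurve D (g s) (g t) (t - s) (fun u => g (s + u)) where
  nonneg := by linarith
  lip a ha b hb := by
    have := hg.lip (s + a) ⟨by linarith [ha.1], by linarith [ha.2]⟩ (s + b)
      ⟨by linarith [hb.1], by linarith [hb.2]⟩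
    rwa [show s + a - (s + b) = a - b by ring] at this
  left := by simp
  right := by simp
  mem u hu := hg.mem _ ⟨by linarith [hu.1], by linarith [hu.2]⟩

theorem trans (hg : IsLipCurve D x y L g) (hh : IsLipCurve D y z M h) :
    IsLipCurve D x z (L + M) (fun u => if u ≤ L then g u else h (u - L)) := by
  have hL := hg.nonneg
  have hM := hh.nonneg
  have key : ∀ s ∈ Icc 0 (L + M), ∀ t ∈ Icc 0 (L + M), s ≤ t →
      dist (if s ≤ L then g s else h (s - L)) (if t ≤ L then g t else h (t - L)) ≤ |s - t| := by
    intro s hs t ht hst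
    by_cases h1 : t ≤ L
    · rw [if_pos h1, if_pos (hst.trans h1)]
      exact hg.lip s ⟨hs.1, hst.trans h1⟩ t ⟨ht.1, h1⟩
    · push Not at h1
      rw [if_neg (not_le.2 h1)]
      have hb := hh.lip 0 ⟨le_rfl, hM⟩ (t - L) ⟨by linarith, by linarith [ht.2]⟩
      by_cases h2 : s ≤ L
      · rw [if_pos h2]
        have ha := hg.lip s ⟨hs.1, h2⟩ L ⟨hL, le_rfl⟩
        rw [hg.right, ← hh.left] at ha
        refine (dist_triangle _ (h 0) _).trans ?_
        rw [abs_of_nonpos (by linarith)] at ha hb ⊢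
        linarith
      · push Not at h2
        rw [if_neg (not_le.2 h2)]
        have := hh.lip (s - L) ⟨by linarith, by linarith [hs.2]⟩ (t - L)
          ⟨by linarith, by linarith [ht.2]⟩
        rwa [show s - L - (t - L) = s - t by ring] at this
  refine ⟨by linarith, fun s hs t ht => ?_, ?_, ?_, fun u hu => ?_⟩
  · rcases le_total s t with hst | hst
    · exact key s hs t ht hst
    · rw [dist_comm, abs_sub_comm]
      exact key t ht s hs hst
  · simp [hL, hg.left]
  · rcases hM.eq_or_lt with h0 | h0
    · subst h0
      simp [hg.right, ← hh.right, hh.left]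
    · simp [not_le.2 h0, hh.right]
  · by_cases h1 : u ≤ L
    · simp only [h1, if_true]
      exact hg.mem u ⟨hu.1, h1⟩
    · simp only [h1, if_false]
      push Not at h1
      exact hh.mem _ ⟨by linarith, by linarith [hu.2]⟩

end IsLipCurve

namespace IsUnitCurve

variable {x y z : E n} {L M : ℝ} {g h : ℝ → E n}

theorem isLipCurve (hg : IsUnitCurve D x y L g) : IsLipCurve D x y L g := by
  have key : ∀ s ∈ Icc 0 L, ∀ t ∈ Icc 0 L, s ≤ t → dist (g s) (g t) ≤ |s - t| := by
    intro s hs t ht hst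
    have h1 := eVariationOn.edist_le g (s := Icc s t) ⟨le_rfl, hst⟩ ⟨hst, le_rfl⟩
    rw [hg.var s hs t ht hst, edist_dist, ENNReal.ofReal_le_ofReal_iff (by linarith)] at h1
    rwa [abs_of_nonpos (by linarith), neg_sub]
  refine ⟨hg.nonneg, fun s hs t ht => ?_, hg.left, hg.right, hg.mem⟩
  rcases le_total s t with hst | hst
  · exact key s hs t ht hst
  · rw [dist_comm, abs_sub_comm]
    exact key t ht s hs hst

theorem of_dist_eq (hL : 0 ≤ L) (hd : ∀ s ∈ Icc 0 L, ∀ t ∈ Icc 0 L, dist (g s) (g t) = |s - t|)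
    (h0 : g 0 = x) (h1 : g L = y) (hm : ∀ u ∈ Icc 0 L, g u ∈ D) : IsUnitCurve D x y L g := by
  refine ⟨hL, fun s hs t ht hst => le_antisymm ?_ ?_, h0, h1, hm⟩
  · exact eVariationOn_Icc_le_of_lip fun u hu v hv =>
      (hd u ⟨hs.1.trans hu.1, hu.2.trans ht.2⟩ v ⟨hs.1.trans hv.1, hv.2.trans ht.2⟩).le
  · have h1 := eVariationOn.edist_le g (s := Icc s t) ⟨le_rfl, hst⟩ ⟨hst, le_rfl⟩
    rwa [edist_dist, hd s hs t ht, abs_of_nonpos (by linarith), neg_sub] at h1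

theorem exists_segment (h : segment ℝ x y ⊆ D) : ∃ g, IsUnitCurve D x y (dist x y) g := by
  rcases eq_or_ne x y with rfl | hxy
  · refine ⟨fun _ => x, of_dist_eq dist_nonneg (fun s hs t ht => ?_) rfl rfl fun u hu =>
      h (left_mem_segment ℝ x x)⟩
    rw [dist_self] at hs ht
    rw [le_antisymm hs.2 hs.1, le_antisymm ht.2 ht.1]
    simp
  · have hpos : 0 < dist x y := dist_pos.2 hxy
    refine ⟨fun u => AffineMap.lineMap x y (u / dist x y), of_dist_eq dist_nonneg
      (fun s hs t ht => ?_) (by simp) (by simp [div_self hpos.ne']) fun u hu => h ?_⟩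
    · rw [dist_lineMap_lineMap, Real.dist_eq, ← sub_div, abs_div, abs_of_pos hpos,
        div_mul_cancel₀ _ hpos.ne']
    · rw [segment_eq_image_lineMap]
      exact ⟨_, ⟨div_nonneg hu.1 hpos.le, (div_le_one hpos).2 hu.2⟩, rfl⟩

theorem restrict (hg : IsUnitCurve D x y L g) {s t : ℝ} (hs : 0 ≤ s) (hst : s ≤ t) (ht : t ≤ L) :
    IsUnitCurve D (g s) (g t) (t - s) (fun u => g (s + u)) where
  nonneg := by linarith
  var a ha b hb hab := by
    have h1 := eVariationOn.comp_eq_of_monotoneOn g (t := Icc a b) (fun u => s + u)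
      (fun u _ v _ huv => by simpa using huv)
    have h2 := hg.var (s + a) ⟨by linarith [ha.1], by linarith [ha.2]⟩ (s + b)
      ⟨by linarith [hb.1], by linarith [hb.2]⟩ (by linarith)
    rw [image_const_add_Icc, h2] at h1
    rw [show b - a = s + b - (s + a) by ring]
    exact h1
  left := by simp
  right := by simp
  mem u hu := hg.mem _ ⟨by linarith [hu.1], by linarith [hu.2]⟩

theorem trans (hg : IsUnitCurve D x y L g) (hh : IsUnitCurve D y z M h) :
    IsUnitCurve D x z (L + M) (fun u => if u ≤ L then g u else h (u - L)) := by
  have hL := hg.nonneg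
  have hM := hh.nonneg
  have hlip := hg.isLipCurve.trans hh.isLipCurve
  have hA : ∀ s ∈ Icc 0 L, ∀ t ∈ Icc 0 L, s ≤ t →
      eVariationOn (fun u => if u ≤ L then g u else h (u - L)) (Icc s t) =
        ENNReal.ofReal (t - s) := by
    intro s hs t ht hst
    rw [← hg.var s hs t ht hst]
    exact eVariationOn.congr fun u hu => if_pos (hu.2.trans ht.2)
  have hB : ∀ s ∈ Icc L (L + M), ∀ t ∈ Icc L (L + M), s ≤ t →
      eVariationOn (fun u => if u ≤ L then g u else h (u - L)) (Icc s t) =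
        ENNReal.ofReal (t - s) := by
    intro s hs t ht hst
    have h1 := eVariationOn.comp_eq_of_monotoneOn h (t := Icc s t) (fun u => u - L)
      (fun u _ v _ huv => by simpa using huv)
    have h2 := hh.var (s - L) ⟨by linarith [hs.1], by linarith [hs.2]⟩ (t - L)
      ⟨by linarith [ht.1], by linarith [ht.2]⟩ (by linarith)
    rw [image_sub_const_Icc, h2] at h1
    rw [show t - s = t - L - (s - L) by ring, ← h1]
    refine eVariationOn.congr fun u hu => ?_
    rcases (hs.1.trans hu.1).eq_or_lt with h0 | h0
    · subst h0
      simp [hg.right, hh.left]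
    · simp [not_le.2 h0]
  refine ⟨hlip.nonneg, fun s hs t ht hst => ?_, hlip.left, hlip.right, hlip.mem⟩
  rcases le_total t L with h1 | h1
  · exact hA s ⟨hs.1, hst.trans h1⟩ t ⟨ht.1, h1⟩ hst
  · rcases le_total L s with h2 | h2
    · exact hB s ⟨h2, hs.2⟩ t ⟨h1, ht.2⟩ hst
    · have := eVariationOn.Icc_add_Icc (fun u => if u ≤ L then g u else h (u - L))
        (s := univ) h2 h1 (mem_univ _)
      simp only [univ_inter] at this
      rw [← this, hA s ⟨hs.1, h2⟩ L ⟨hL, le_rfl⟩ h2,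
        hB L ⟨le_rfl, by linarith⟩ t ⟨h1, ht.2⟩ h1, ← ENNReal.ofReal_add (by linarith)
        (by linarith)]
      congr 1; ring

end IsUnitCurve

theorem exists_unitCurve_of_dist_lt (hO : IsOpen D) {x y : E n} (hx : x ∈ D)
    (h : dist x y < bdryDist D x) : ∃ g, IsUnitCurve D x y (dist x y) g :=
  IsUnitCurve.exists_segment <| ((convex_ball x _).segment_subset
    (Metric.mem_ball_self (dist_nonneg.trans_lt h)) (by rwa [Metric.mem_ball, dist_comm])).trans
    (ball_bdryDist_subset hO hx)

/-- Nearby points are joined by segments, and connectedness chains these together. -/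
theorem exists_unitCurve (hO : IsOpen D) (hF : (frontier D).Nonempty) (hc : IsPreconnected D)
    {x y : E n} (hx : x ∈ D) (hy : y ∈ D) : ∃ L g, IsUnitCurve D x y L g := by
  refine hc.induction₂' (fun x y => ∃ L g, IsUnitCurve D x y L g) (fun z hz => ?_) ?_ hx hy
  · have h1 : ∀ᶠ w in 𝓝[D] z, dist w z < bdryDist D z :=
      mem_nhdsWithin_of_mem_nhds (Metric.ball_mem_nhds z (bdryDist_pos hO hF hz))
    have h2 : ∀ᶠ w in 𝓝[D] z, dist w z < bdryDist D w := by
      refine mem_nhdsWithin_of_mem_nhds ?_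
      refine (isOpen_lt (f := fun w => dist w z) (by fun_prop) (continuous_bdryDist D)).mem_nhds ?_
      simpa using bdryDist_pos hO hF hz
    filter_upwards [h1, h2, self_mem_nhdsWithin] with w hw1 hw2 hwD
    exact ⟨⟨_, exists_unitCurve_of_dist_lt hO hz (by rwa [dist_comm])⟩,
      ⟨_, exists_unitCurve_of_dist_lt hO hwD hw2⟩⟩
  · rintro a b c - - - ⟨L, g, hg⟩ ⟨M, h, hh⟩
    exact ⟨_, _, hg.trans hh⟩

end

/-! ### Rectifiable paths as arc length curves; the quasihyperbolic metric -/

section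

variable {n : ℕ} {D : Set (E n)} {x y : E n}

section PathToCurve

variable (γ : Path x y)

theorem boundedVariationOn_of_pathLength (hfin : pathLength γ ≠ ⊤) :
    BoundedVariationOn γ univ := hfin

/-- A jump of the variation function has the size of a jump of `γ`, and `γ` has none. -/
theorem continuous_variationOnFromTo (hfin : pathLength γ ≠ ⊤) :
    Continuous (variationOnFromTo γ univ 0) := by
  have hf : LocallyBoundedVariationOn γ univ :=
    (boundedVariationOn_of_pathLength γ hfin).locallyBoundedVariationOn
  refine continuous_iff_continuousAt.2 fun b => ?_
  refine continuousAt_iff_continuous_left'_right'.2 ⟨?_, ?_⟩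
  · have := variationOnFromTo.tendsto_left (a := 0) (b := b) (mem_univ _) (mem_univ _) hf
      (l := γ b) (γ.continuous.continuousAt.tendsto.mono_left nhdsWithin_le_nhds)
    simpa [ContinuousWithinAt] using this
  · have := variationOnFromTo.tendsto_right (a := 0) (b := b) (mem_univ _) (mem_univ _) hf
      (l := γ b) (γ.continuous.continuousAt.tendsto.mono_left nhdsWithin_le_nhds)
    simpa [ContinuousWithinAt] using this

theorem variationOnFromTo_eq_Iic (t : unitInterval) :
    variationOnFromTo γ univ 0 t = (eVariationOn γ (Iic t)).toReal := by
  rw [variationOnFromTo.eq_of_le _ _ (show (0 : unitInterval) ≤ t from t.2.1)]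
  congr 2
  ext u
  simp

theorem eVariationOn_Iic_add_Ici (t : unitInterval) :
    eVariationOn γ (Iic t) + eVariationOn γ (Ici t) = pathLength γ := by
  rw [← eVariationOn.union γ (x := t) isGreatest_Iic isLeast_Ici, Iic_union_Ici]
  rfl

theorem variationOnFromTo_one :
    variationOnFromTo γ univ 0 1 = (pathLength γ).toReal := by
  rw [variationOnFromTo_eq_Iic]
  have : Iic (1 : unitInterval) = univ := by ext u; simp [unitInterval.le_one']
  rw [this]; rfl

theorem image_variationOnFromTo (hfin : pathLength γ ≠ ⊤) :
    variationOnFromTo γ univ 0 '' univ = Icc 0 (pathLength γ).toReal := by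
  have hf : LocallyBoundedVariationOn γ univ :=
    (boundedVariationOn_of_pathLength γ hfin).locallyBoundedVariationOn
  have hmono := variationOnFromTo.monotoneOn hf (mem_univ (0 : unitInterval))
  apply Subset.antisymm
  · rintro _ ⟨t, -, rfl⟩
    refine ⟨variationOnFromTo.nonneg_of_le _ _ (unitInterval.nonneg t), ?_⟩
    rw [← variationOnFromTo_one]
    exact hmono (mem_univ _) (mem_univ _) (unitInterval.le_one' )
  · rw [← variationOnFromTo_one, ← variationOnFromTo.self γ univ (0 : unitInterval)]
    have := isPreconnected_univ.intermediate_value (mem_univ (0 : unitInterval))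
      (mem_univ (1 : unitInterval)) (continuous_variationOnFromTo γ hfin).continuousOn
    exact this

theorem naturalParameterization_variationOnFromTo (hfin : pathLength γ ≠ ⊤) (t : unitInterval) :
    naturalParameterization γ univ 0 (variationOnFromTo γ univ 0 t) = γ t :=
  edist_eq_zero.1 <| edist_naturalParameterization_eq_zero
    (boundedVariationOn_of_pathLength γ hfin).locallyBoundedVariationOn (mem_univ _) (mem_univ _)

theorem isUnitCurve_naturalParameterization (hγ : range γ ⊆ D) (hfin : pathLength γ ≠ ⊤) :
    IsUnitCurve D x y (pathLength γ).toReal (naturalParameterization γ univ 0) := by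
  have hs := has_unit_speed_naturalParameterization γ
    (boundedVariationOn_of_pathLength γ hfin).locallyBoundedVariationOn
    (mem_univ (0 : unitInterval))
  rw [image_variationOnFromTo γ hfin] at hs
  refine ⟨ENNReal.toReal_nonneg, fun s hs' t ht hst => ?_, ?_, ?_, fun u _ => ?_⟩
  · have := hs hs' ht
    rw [inter_eq_right.2 (Icc_subset_Icc hs'.1 ht.2)] at this
    simpa using this
  · have := naturalParameterization_variationOnFromTo γ hfin 0
    rwa [variationOnFromTo.self, γ.source] at this
  · have := naturalParameterization_variationOnFromTo γ hfin 1
    rwa [variationOnFromTo_one, γ.target] at this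
  · exact hγ ⟨_, rfl⟩

theorem exists_naturalParameterization_eq (hfin : pathLength γ ≠ ⊤) {u : ℝ}
    (hu : u ∈ Icc 0 (pathLength γ).toReal) :
    ∃ t : unitInterval, naturalParameterization γ univ 0 u = γ t ∧
      eVariationOn γ (Iic t) = ENNReal.ofReal u ∧
      eVariationOn γ (Ici t) = ENNReal.ofReal ((pathLength γ).toReal - u) := by
  rw [← image_variationOnFromTo γ hfin] at hu
  obtain ⟨t, -, rfl⟩ := hu
  have hadd := eVariationOn_Iic_add_Ici γ t
  have h1 : eVariationOn γ (Iic t) ≠ ⊤ := fun h => hfin (by rw [← hadd, h, top_add])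
  have h2 : eVariationOn γ (Ici t) ≠ ⊤ := fun h => hfin (by rw [← hadd, h, add_top])
  refine ⟨t, naturalParameterization_variationOnFromTo γ hfin t, ?_, ?_⟩
  · rw [variationOnFromTo_eq_Iic, ENNReal.ofReal_toReal h1]
  · rw [variationOnFromTo_eq_Iic, ← hadd, ENNReal.toReal_add h1 h2, add_sub_cancel_left,
      ENNReal.ofReal_toReal h2]

end PathToCurve

section CurveToPath

variable {L : ℝ} {g : ℝ → E n}

/-- The path on the unit interval obtained by rescaling a Lipschitz curve. -/
def IsLipCurve.toPath (hg : IsLipCurve D x y L g) : Path x y where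
  toFun t := g (L * t)
  continuous_toFun := hg.continuousOn.comp_continuous (by fun_prop) fun t =>
    ⟨mul_nonneg hg.nonneg t.2.1, mul_le_of_le_one_right hg.nonneg t.2.2⟩
  source' := by simp [hg.left]
  target' := by simp [hg.right]

theorem IsLipCurve.toPath_apply (hg : IsLipCurve D x y L g) (t : unitInterval) :
    hg.toPath t = g (L * t) := rfl

theorem IsLipCurve.range_toPath_subset (hg : IsLipCurve D x y L g) : range hg.toPath ⊆ D := by
  rintro _ ⟨t, rfl⟩
  exact hg.mem _ ⟨mul_nonneg hg.nonneg t.2.1, mul_le_of_le_one_right hg.nonneg t.2.2⟩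

theorem IsLipCurve.eVariationOn_toPath (hg : IsLipCurve D x y L g) (s : Set unitInterval) :
    eVariationOn hg.toPath s = eVariationOn g ((fun t : unitInterval => L * (t : ℝ)) '' s) :=
  eVariationOn.comp_eq_of_monotoneOn g (fun t : unitInterval => L * (t : ℝ))
    fun _ _ _ _ h => mul_le_mul_of_nonneg_left h hg.nonneg

theorem IsLipCurve.eVariationOn_Icc_le (hg : IsLipCurve D x y L g) {s t : ℝ} (hs : 0 ≤ s)
    (ht : t ≤ L) : eVariationOn g (Icc s t) ≤ ENNReal.ofReal (t - s) :=
  eVariationOn_Icc_le_of_lip fun u hu v hv =>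
    hg.lip u ⟨hs.trans hu.1, hu.2.trans ht⟩ v ⟨hs.trans hv.1, hv.2.trans ht⟩

theorem IsLipCurve.eVariationOn_toPath_Iic_le (hg : IsLipCurve D x y L g) (t : unitInterval) :
    eVariationOn hg.toPath (Iic t) ≤ ENNReal.ofReal (L * t) := by
  rw [hg.eVariationOn_toPath]
  refine (eVariationOn.mono g (s := Icc 0 (L * t)) ?_).trans
    ((hg.eVariationOn_Icc_le le_rfl
      (mul_le_of_le_one_right hg.nonneg t.2.2)).trans_eq (by rw [sub_zero]))
  rintro _ ⟨u, hu, rfl⟩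
  exact ⟨mul_nonneg hg.nonneg u.2.1, mul_le_mul_of_nonneg_left hu hg.nonneg⟩

theorem IsLipCurve.eVariationOn_toPath_Ici_le (hg : IsLipCurve D x y L g) (t : unitInterval) :
    eVariationOn hg.toPath (Ici t) ≤ ENNReal.ofReal (L - L * t) := by
  rw [hg.eVariationOn_toPath]
  refine (eVariationOn.mono g (s := Icc (L * t) L) ?_).trans
    (hg.eVariationOn_Icc_le (mul_nonneg hg.nonneg t.2.1) le_rfl)
  rintro _ ⟨u, hu, rfl⟩
  exact ⟨mul_le_mul_of_nonneg_left hu hg.nonneg, mul_le_of_le_one_right hg.nonneg u.2.2⟩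

theorem IsLipCurve.pathLength_toPath_le (hg : IsLipCurve D x y L g) :
    pathLength hg.toPath ≤ ENNReal.ofReal L := by
  have h := hg.eVariationOn_toPath_Ici_le 0
  have : Ici (0 : unitInterval) = univ := by ext u; simp
  rw [this] at h
  simpa [pathLength] using h

theorem IsLipCurve.innerLengthDist_le (hg : IsLipCurve D x y L g) :
    innerLengthDist D x y ≤ ENNReal.ofReal L :=
  le_trans (sInf_le (⟨hg.toPath, hg.range_toPath_subset,
    (hg.pathLength_toPath_le.trans_lt ENNReal.ofReal_lt_top).ne, rfl⟩ :
      ∃ γ : Path x y, range γ ⊆ D ∧ pathLength γ ≠ ⊤ ∧ pathLength hg.toPath = pathLength γ))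
    hg.pathLength_toPath_le

theorem IsUnitCurve.eVariationOn_toPath_Icc (hg : IsUnitCurve D x y L g) (t : unitInterval) :
    eVariationOn hg.isLipCurve.toPath (Icc 0 t) = ENNReal.ofReal (L * t) := by
  have hLt : 0 ≤ L * (t : ℝ) := mul_nonneg hg.nonneg t.2.1
  have hLt' : L * (t : ℝ) ≤ L := mul_le_of_le_one_right hg.nonneg t.2.2
  have himg : (fun u : unitInterval => L * (u : ℝ)) '' Icc 0 t = Icc 0 (L * t) := by
    apply Subset.antisymm
    · rintro _ ⟨u, hu, rfl⟩
      exact ⟨mul_nonneg hg.nonneg u.2.1, mul_le_mul_of_nonneg_left hu.2 hg.nonneg⟩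
    · intro v hv
      rcases hg.nonneg.eq_or_lt with h0 | h0
      · refine ⟨0, ⟨le_rfl, unitInterval.nonneg t⟩, ?_⟩
        subst h0
        simp only [zero_mul, Icc_self, mem_singleton_iff] at hv ⊢
        exact hv.symm
      · have h1 : v / L ≤ t := (div_le_iff₀' h0).2 hv.2
        exact ⟨⟨v / L, div_nonneg hv.1 h0.le, h1.trans t.2.2⟩,
          ⟨div_nonneg hv.1 h0.le, h1⟩, mul_div_cancel₀ _ h0.ne'⟩
  rw [IsLipCurve.eVariationOn_toPath, himg, hg.var 0 ⟨le_rfl, hg.nonneg⟩ _ ⟨hLt, hLt'⟩ hLt,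
    sub_zero]

theorem IsUnitCurve.pathLength_toPath (hg : IsUnitCurve D x y L g) :
    pathLength hg.isLipCurve.toPath = ENNReal.ofReal L := by
  have h := hg.eVariationOn_toPath_Icc 1
  have : Icc (0 : unitInterval) 1 = univ := by
    ext u; simp [unitInterval.le_one']
  rw [this] at h
  simpa [pathLength] using h

theorem IsUnitCurve.naturalParameterization_toPath (hg : IsUnitCurve D x y L g) {u : ℝ}
    (hu : u ∈ Icc 0 L) : naturalParameterization hg.isLipCurve.toPath univ 0 u = g u := by
  have hfin : pathLength hg.isLipCurve.toPath ≠ ⊤ := by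
    rw [hg.pathLength_toPath]; exact ENNReal.ofReal_ne_top
  obtain ⟨t, h1, h2, -⟩ := exists_naturalParameterization_eq hg.isLipCurve.toPath hfin (u := u)
    (by rwa [hg.pathLength_toPath, ENNReal.toReal_ofReal hg.nonneg])
  have h3 := hg.eVariationOn_toPath_Icc t
  have : Icc 0 t = Iic t := by ext u; simp
  rw [this, h2, ENNReal.ofReal_eq_ofReal_iff hu.1 (mul_nonneg hg.nonneg t.2.1)] at h3
  rw [h1, IsLipCurve.toPath_apply, h3]

theorem IsUnitCurve.arcLengthIntegral_toPath (hg : IsUnitCurve D x y L g) (w : E n → ℝ) :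
    arcLengthIntegral hg.isLipCurve.toPath w = ∫ u in (0 : ℝ)..L, w (g u) := by
  rw [arcLengthIntegral, hg.pathLength_toPath, ENNReal.toReal_ofReal hg.nonneg]
  refine intervalIntegral.integral_congr fun u hu => ?_
  rw [uIcc_of_le hg.nonneg] at hu
  simp only [hg.naturalParameterization_toPath hu]

end CurveToPath

/-- Arc length curves on `[0, L]` can be cut and concatenated without reparametrizing, so the
infimum is taken over them from here on. -/
theorem mem_quasihyperbolicDist_set {r : ℝ} :
    (∃ γ : Path x y, range γ ⊆ D ∧ pathLength γ ≠ ⊤ ∧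
      r = arcLengthIntegral γ (fun z => 1 / bdryDist D z)) ↔
    ∃ L g, IsUnitCurve D x y L g ∧ r = ∫ u in (0 : ℝ)..L, 1 / bdryDist D (g u) := by
  constructor
  · rintro ⟨γ, h1, h2, rfl⟩
    exact ⟨_, _, isUnitCurve_naturalParameterization γ h1 h2, rfl⟩
  · rintro ⟨L, g, hg, rfl⟩
    refine ⟨hg.isLipCurve.toPath, hg.isLipCurve.range_toPath_subset, ?_,
      (hg.arcLengthIntegral_toPath fun z => 1 / bdryDist D z).symm⟩
    rw [hg.pathLength_toPath]; exact ENNReal.ofReal_ne_top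

theorem quasihyperbolicDist_eq (D : Set (E n)) (x y : E n) :
    quasihyperbolicDist D x y = sInf {r : ℝ | ∃ L g, IsUnitCurve D x y L g ∧
      r = ∫ u in (0 : ℝ)..L, 1 / bdryDist D (g u)} := by
  rw [quasihyperbolicDist]
  congr 1
  ext r
  exact mem_quasihyperbolicDist_set

theorem quasihyperbolicDist_le {L : ℝ} {g : ℝ → E n} (hg : IsUnitCurve D x y L g) :
    quasihyperbolicDist D x y ≤ ∫ u in (0 : ℝ)..L, 1 / bdryDist D (g u) := by
  rw [quasihyperbolicDist_eq]
  refine csInf_le ⟨0, ?_⟩ ⟨L, g, hg, rfl⟩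
  rintro _ ⟨M, h, hh, rfl⟩
  exact intervalIntegral.integral_nonneg hh.nonneg fun u _ =>
    one_div_nonneg.2 (bdryDist_nonneg D _)

/-- Openness and connectedness supply a competitor; over an empty family the real infimum would be
the default value 0. -/
theorem le_quasihyperbolicDist (hO : IsOpen D) (hF : (frontier D).Nonempty)
    (hc : IsPreconnected D) (hx : x ∈ D) (hy : y ∈ D) {b : ℝ}
    (h : ∀ L g, IsUnitCurve D x y L g → b ≤ ∫ u in (0 : ℝ)..L, 1 / bdryDist D (g u)) :
    b ≤ quasihyperbolicDist D x y := by
  rw [quasihyperbolicDist_eq]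
  obtain ⟨L, g, hg⟩ := exists_unitCurve hO hF hc hx hy
  refine le_csInf ⟨_, L, g, hg, rfl⟩ ?_
  rintro _ ⟨M, h', hh, rfl⟩
  exact h M h' hh

theorem exists_unitCurve_integral_lt (hO : IsOpen D) (hF : (frontier D).Nonempty)
    (hc : IsPreconnected D) (hx : x ∈ D) (hy : y ∈ D) {ε : ℝ} (hε : 0 < ε) :
    ∃ L g, IsUnitCurve D x y L g ∧
      ∫ u in (0 : ℝ)..L, 1 / bdryDist D (g u) < quasihyperbolicDist D x y + ε := by
  by_contra! hcon
  have := le_quasihyperbolicDist hO hF hc hx hy hcon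
  linarith

end

section

variable {n : ℕ} {D K : Set (E n)} {x y : E n} {L : ℝ} {g : ℝ → E n}

/-! ### Shortest curves in a compact set -/

section Shortest

/-- Clamping the parameter makes curves of different lengths functions on all of `ℝ`, hence points
of one product space. -/
theorem IsLipCurve.exists_extend (hg : IsLipCurve D x y L g) :
    ∃ h : ℝ → E n, (∀ t, h t ∈ D) ∧ (∀ s t, dist (h s) (h t) ≤ |s - t|) ∧ h 0 = x ∧ h L = y := by
  have hm : ∀ t, max 0 (min t L) ∈ Icc 0 L := fun t =>
    ⟨le_max_left _ _, max_le hg.nonneg (min_le_right _ _)⟩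
  refine ⟨fun t => g (max 0 (min t L)), fun t => hg.mem _ (hm t), fun s t => ?_, ?_, ?_⟩
  · refine (hg.lip _ (hm s) _ (hm t)).trans ?_
    refine (abs_max_sub_max_le_max _ _ _ _).trans (max_le (by simp) ?_)
    exact (abs_min_sub_min_le_max _ _ _ _).trans (max_le le_rfl (by simp))
  · simp [hg.nonneg, hg.left]
  · simp [hg.nonneg, hg.right]

/-- Tychonoff: pairs (length, curve) form a compact set for pointwise convergence, on which the
length attains its minimum. -/
theorem exists_shortest_lipCurve (hK : IsCompact K) (hg : IsLipCurve K x y L g) :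
    ∃ M h, IsLipCurve K x y M h ∧ ∀ M' h', IsLipCurve K x y M' h' → M ≤ M' := by
  -- The last condition encodes `p.2 p.1 = y`. Evaluation at a varying parameter is not continuous
  -- for pointwise convergence, but each of these inequalities is a closed condition.
  let S : Set (ℝ × (ℝ → E n)) := {p | p.1 ∈ Icc 0 L ∧ (∀ t, p.2 t ∈ K) ∧
    (∀ s t, dist (p.2 s) (p.2 t) ≤ |s - t|) ∧ p.2 0 = x ∧ ∀ s, dist (p.2 s) y ≤ |s - p.1|}
  have hScl : IsClosed S := by
    refine IsClosed.and (isClosed_Icc.preimage continuous_fst) (IsClosed.and ?_ (IsClosed.and ?_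
      (IsClosed.and ?_ ?_)))
    · simp only [ofPred_forall]
      exact isClosed_iInter fun t => hK.isClosed.preimage (by fun_prop)
    · simp only [ofPred_forall]
      exact isClosed_iInter fun s => isClosed_iInter fun t => isClosed_le (by fun_prop) (by fun_prop)
    · exact isClosed_eq (by fun_prop) (by fun_prop)
    · simp only [ofPred_forall]
      exact isClosed_iInter fun s => isClosed_le (by fun_prop) (by fun_prop)
  have hScpt : IsCompact S := by
    refine ((isCompact_Icc (a := (0 : ℝ)) (b := L)).prod
      (isCompact_univ_pi fun _ : ℝ => hK)).of_isClosed_subset hScl ?_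
    rintro p ⟨h1, h2, -⟩
    exact ⟨h1, fun t _ => h2 t⟩
  have hmem : ∀ {M h}, IsLipCurve K x y M h → M ≤ L → ∃ h', (M, h') ∈ S := by
    intro M h hh hM
    obtain ⟨h', h1, h2, h3, h4⟩ := hh.exists_extend
    refine ⟨h', ⟨hh.nonneg, hM⟩, h1, h2, h3, fun s => ?_⟩
    have := h2 s M
    rwa [h4] at this
  obtain ⟨g', hg'⟩ := hmem hg le_rfl
  obtain ⟨⟨M, h⟩, hMS, hmin⟩ := hScpt.exists_isMinOn ⟨_, hg'⟩ continuous_fst.continuousOn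
  have hMS' := hMS
  obtain ⟨h1, h2, h3, h4, h5⟩ := hMS
  refine ⟨M, h, ⟨h1.1, fun s _ t _ => h3 s t, h4, ?_, fun u _ => h2 u⟩, fun M' h' hh' => ?_⟩
  · have := h5 M
    simp only [sub_self, abs_zero] at this
    exact dist_le_zero.1 this
  · rcases le_total M' L with hle | hle
    · obtain ⟨h'', hh''⟩ := hmem hh' hle
      exact hmin hh''
    · exact h1.2.trans hle

/-- A repeated value would allow a loop to be cut out. -/
theorem IsLipCurve.injOn_of_shortest (hg : IsLipCurve K x y L g)
    (hmin : ∀ M h, IsLipCurve K x y M h → L ≤ M) : InjOn g (Icc 0 L) := by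
  have key : ∀ s ∈ Icc 0 L, ∀ t ∈ Icc 0 L, s < t → g s ≠ g t := by
    intro s hs t ht hst heq
    have h1 := hg.restrict le_rfl hs.1 hs.2
    have h2 := hg.restrict ht.1 ht.2 le_rfl
    rw [hg.left, heq] at h1
    rw [hg.right] at h2
    have := hmin _ _ (h1.trans h2)
    linarith
  intro s hs t ht heq
  by_contra hne
  rcases lt_or_gt_of_ne hne with h | h
  · exact key s hs t ht h heq
  · exact key t ht s hs h heq.symm

/-- Passing to a shortest curve inside the range, a Lipschitz curve can be replaced by an arc
without losing a lower bound on `f` by the distance to the endpoints along the curve. -/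
theorem IsLipCurve.exists_arc (hg : IsLipCurve D x y L g) {f : E n → ℝ}
    (hf : ∀ s ∈ Icc 0 L, min s (L - s) ≤ f (g s)) :
    ∃ γ : Path x y, IsArc γ ∧ range γ ⊆ D ∧ pathLength γ ≤ ENNReal.ofReal L ∧
      ∀ t, min (eVariationOn γ (Iic t)) (eVariationOn γ (Ici t)) ≤ ENNReal.ofReal (f (γ t)) := by
  have hK : IsCompact (g '' Icc 0 L) := isCompact_Icc.image_of_continuousOn hg.continuousOn
  have hgK : IsLipCurve (g '' Icc 0 L) x y L g :=
    ⟨hg.nonneg, hg.lip, hg.left, hg.right, fun u hu => ⟨u, hu, rfl⟩⟩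
  have hKD : g '' Icc 0 L ⊆ D := by rintro _ ⟨u, hu, rfl⟩; exact hg.mem u hu
  obtain ⟨M, h, hh, hmin⟩ := exists_shortest_lipCurve hK hgK
  have hinj := hh.injOn_of_shortest hmin
  refine ⟨hh.toPath, ?_, hh.range_toPath_subset.trans hKD, hh.pathLength_toPath_le.trans
    (ENNReal.ofReal_le_ofReal (hmin _ _ hgK)), fun t => ?_⟩
  · rcases hh.nonneg.eq_or_lt with h0 | h0
    · right
      intro t
      rw [IsLipCurve.toPath_apply, ← h0, zero_mul, hh.left]
    · left
      intro s t hst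
      have := hinj ⟨mul_nonneg hh.nonneg s.2.1, mul_le_of_le_one_right hh.nonneg s.2.2⟩
        ⟨mul_nonneg hh.nonneg t.2.1, mul_le_of_le_one_right hh.nonneg t.2.2⟩ hst
      exact Subtype.ext (mul_left_cancel₀ h0.ne' this)
  · set u := M * (t : ℝ) with hu
    have hu0 : 0 ≤ u := mul_nonneg hh.nonneg t.2.1
    have huM : u ≤ M := mul_le_of_le_one_right hh.nonneg t.2.2
    obtain ⟨s, hs, hsu⟩ := hh.mem u ⟨hu0, huM⟩
    have hA1 := hgK.restrict le_rfl hs.1 hs.2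
    have hA2 := hh.restrict hu0 huM le_rfl
    have hB1 := hh.restrict le_rfl hu0 huM
    have hB2 := hgK.restrict hs.1 hs.2 le_rfl
    rw [hg.left, hsu] at hA1
    rw [hh.right] at hA2
    rw [hh.left] at hB1
    rw [hg.right, hsu] at hB2
    -- The point at parameter `u` on the shortest curve is at parameter `s` on the old one. Swapping
    -- initial or final pieces at this point gives `u ≤ s` and `M - u ≤ L - s`.
    have h1 := hmin _ _ (hA1.trans hA2)
    have h2 := hmin _ _ (hB1.trans hB2)
    have h3 := hf s hs
    rw [hsu] at h3
    rw [IsLipCurve.toPath_apply, ← hu]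
    rcases min_le_iff.1 h3 with h4 | h4
    · exact (min_le_left _ _).trans ((hh.eVariationOn_toPath_Iic_le t).trans
        (ENNReal.ofReal_le_ofReal (by linarith)))
    · exact (min_le_right _ _).trans ((hh.eVariationOn_toPath_Ici_le t).trans
        (ENNReal.ofReal_le_ofReal (by linarith)))

end Shortest

/-! ### Lipschitz weights with logarithmically controlled integrals -/

section RealAnalysis

/-- A positive `1`-Lipschitz function on `[0, L]`. -/
structure IsLipWeight (δ : ℝ → ℝ) (L : ℝ) : Prop where
  nonneg : 0 ≤ L
  pos : ∀ s ∈ Icc 0 L, 0 < δ s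
  lip : ∀ s ∈ Icc 0 L, ∀ t ∈ Icc 0 L, |δ s - δ t| ≤ |s - t|

namespace IsLipWeight

variable {δ : ℝ → ℝ} {s t : ℝ}

theorem reverse (h : IsLipWeight δ L) : IsLipWeight (fun u => δ (L - u)) L where
  nonneg := h.nonneg
  pos s hs := h.pos _ ⟨by linarith [hs.2], by linarith [hs.1]⟩
  lip s hs t ht := by
    have := h.lip (L - s) ⟨by linarith [hs.2], by linarith [hs.1]⟩ (L - t)
      ⟨by linarith [ht.2], by linarith [ht.1]⟩
    rwa [show L - s - (L - t) = -(s - t) by ring, abs_neg] at this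

theorem continuousOn (h : IsLipWeight δ L) : ContinuousOn δ (Icc 0 L) := by
  have hL : LipschitzOnWith 1 δ (Icc 0 L) :=
    LipschitzOnWith.of_dist_le_mul fun u hu v hv => by
      simpa [Real.dist_eq] using h.lip u hu v hv
  exact hL.continuousOn

theorem intervalIntegrable (h : IsLipWeight δ L) (hs : 0 ≤ s) (hst : s ≤ t) (ht : t ≤ L) :
    IntervalIntegrable (fun u => 1 / δ u) MeasureTheory.volume s t := by
  apply ContinuousOn.intervalIntegrable
  rw [uIcc_of_le hst]
  exact continuousOn_const.div (h.continuousOn.mono (Icc_subset_Icc hs ht))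
    fun u hu => (h.pos u ⟨hs.trans hu.1, hu.2.trans ht⟩).ne'

theorem integral_nonneg (h : IsLipWeight δ L) (hs : 0 ≤ s) (hst : s ≤ t) (ht : t ≤ L) :
    0 ≤ ∫ u in s..t, 1 / δ u :=
  intervalIntegral.integral_nonneg hst fun u hu =>
    one_div_nonneg.2 (h.pos u ⟨hs.trans hu.1, hu.2.trans ht⟩).le

/-- Integrate `1 / δ u ≥ 1 / (δ s + u - s)`. -/
theorem log_le_integral_left (h : IsLipWeight δ L) (hs : 0 ≤ s) (hst : s ≤ t) (ht : t ≤ L) :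
    Real.log (1 + (t - s) / δ s) ≤ ∫ u in s..t, 1 / δ u := by
  have hp := h.pos s ⟨hs, hst.trans ht⟩
  have h1 : ∫ u in s..t, 1 / (u + (δ s - s)) = Real.log (1 + (t - s) / δ s) := by
    rw [intervalIntegral.integral_comp_add_right (fun u => 1 / u)]
    rw [integral_one_div_of_pos (by linarith) (by linarith)]
    rw [show t + (δ s - s) = δ s + (t - s) by ring, show s + (δ s - s) = δ s by ring, add_div,
      div_self hp.ne']
  rw [← h1]
  refine intervalIntegral.integral_mono_on hst ?_ (h.intervalIntegrable hs hst ht) fun u hu => ?_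
  · apply ContinuousOn.intervalIntegrable
    rw [uIcc_of_le hst]
    exact continuousOn_const.div (by fun_prop) fun u hu => by linarith [hu.1]
  · have hu' : u ∈ Icc 0 L := ⟨hs.trans hu.1, hu.2.trans ht⟩
    have := h.lip s ⟨hs, hst.trans ht⟩ u hu'
    rw [abs_of_nonpos (by linarith [hu.1] : s - u ≤ 0)] at this
    exact one_div_le_one_div_of_le (h.pos u hu') (by linarith [(abs_le.1 this).1])

theorem integral_reverse (δ : ℝ → ℝ) (L s t : ℝ) :
    ∫ u in s..t, 1 / δ (L - u) = ∫ u in (L - t)..(L - s), 1 / δ u :=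
  intervalIntegral.integral_comp_sub_left (fun u => 1 / δ u) L

theorem log_le_integral_right (h : IsLipWeight δ L) (hs : 0 ≤ s) (hst : s ≤ t) (ht : t ≤ L) :
    Real.log (1 + (t - s) / δ t) ≤ ∫ u in s..t, 1 / δ u := by
  have := h.reverse.log_le_integral_left (s := L - t) (t := L - s) (by linarith) (by linarith)
    (by linarith)
  rw [integral_reverse] at this
  simpa using this

theorem add_le_mul_exp_left (h : IsLipWeight δ L) (hs : 0 ≤ s) (hst : s ≤ t) (ht : t ≤ L) :
    δ s + (t - s) ≤ δ s * Real.exp (∫ u in s..t, 1 / δ u) := by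
  have hp := h.pos s ⟨hs, hst.trans ht⟩
  have h0 : 0 ≤ (t - s) / δ s := div_nonneg (by linarith) hp.le
  have h1 := Real.exp_le_exp.2 (h.log_le_integral_left hs hst ht)
  rw [Real.exp_log (by linarith)] at h1
  calc δ s + (t - s) = δ s * (1 + (t - s) / δ s) := by field_simp
    _ ≤ _ := mul_le_mul_of_nonneg_left h1 hp.le

theorem add_le_mul_exp_right (h : IsLipWeight δ L) (hs : 0 ≤ s) (hst : s ≤ t) (ht : t ≤ L) :
    δ t + (t - s) ≤ δ t * Real.exp (∫ u in s..t, 1 / δ u) := by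
  have hp := h.pos t ⟨hs.trans hst, ht⟩
  have h0 : 0 ≤ (t - s) / δ t := div_nonneg (by linarith) hp.le
  have h1 := Real.exp_le_exp.2 (h.log_le_integral_right hs hst ht)
  rw [Real.exp_log (by linarith)] at h1
  calc δ t + (t - s) = δ t * (1 + (t - s) / δ t) := by field_simp
    _ ≤ _ := mul_le_mul_of_nonneg_left h1 hp.le

theorem div_le_integral (h : IsLipWeight δ L) (hs : 0 ≤ s) (hst : s ≤ t) (ht : t ≤ L) {Δ : ℝ}
    (hΔ : ∀ u ∈ Icc s t, δ u ≤ Δ) : (t - s) / Δ ≤ ∫ u in s..t, 1 / δ u := by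
  have : ∫ _ in s..t, 1 / Δ = (t - s) / Δ := by
    rw [intervalIntegral.integral_const, smul_eq_mul]; ring
  rw [← this]
  refine intervalIntegral.integral_mono_on hst (by simp) (h.intervalIntegrable hs hst ht)
    fun u hu => one_div_le_one_div_of_le (h.pos u ⟨hs.trans hu.1, hu.2.trans ht⟩) (hΔ u hu)

theorem integral_mono_interval (h : IsLipWeight δ L) {a b : ℝ} (ha : 0 ≤ a) (has : a ≤ s)
    (hst : s ≤ t) (htb : t ≤ b) (hb : b ≤ L) :
    ∫ u in s..t, 1 / δ u ≤ ∫ u in a..b, 1 / δ u := by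
  rw [← intervalIntegral.integral_add_adjacent_intervals
      (h.intervalIntegrable ha has (by linarith)) (h.intervalIntegrable (by linarith)
        (hst.trans htb) hb),
    ← intervalIntegral.integral_add_adjacent_intervals
      (h.intervalIntegrable (ha.trans has) hst (by linarith))
      (h.intervalIntegrable (by linarith) htb hb)]
  have h1 := h.integral_nonneg ha has (by linarith)
  have h2 := h.integral_nonneg (s := t) (by linarith) htb hb
  linarith

end IsLipWeight

theorem exists_first_hit {δ : ℝ → ℝ} {a b r : ℝ} (hab : a ≤ b) (hc : ContinuousOn δ (Icc a b))
    (ha : δ a ≤ r) (hb : r ≤ δ b) : ∃ q ∈ Icc a b, δ q = r ∧ ∀ u ∈ Icc a q, δ u ≤ r := by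
  have hcl : IsClosed (Icc a b ∩ δ ⁻¹' Ici r) := hc.preimage_isClosed_of_isClosed isClosed_Icc
    isClosed_Ici
  have hcpt : IsCompact (Icc a b ∩ δ ⁻¹' Ici r) :=
    isCompact_Icc.of_isClosed_subset hcl inter_subset_left
  obtain ⟨q, ⟨hq, hqr⟩, hleast⟩ := hcpt.exists_isLeast ⟨b, ⟨hab, le_rfl⟩, hb⟩
  obtain ⟨u, hu, hur⟩ := intermediate_value_Icc hq.1
    (hc.mono (Icc_subset_Icc le_rfl hq.2)) ⟨ha, hqr⟩
  have hqu : q ≤ u := hleast ⟨⟨hu.1, hu.2.trans hq.2⟩, hur.ge⟩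
  have hqe : q = u := le_antisymm hqu hu.2
  refine ⟨q, hq, by rw [hqe, hur], fun v hv => ?_⟩
  by_contra! hcon
  have := hleast ⟨⟨hv.1, hv.2.trans hq.2⟩, hcon.le⟩
  have hvq : v = q := le_antisymm hv.2 this
  rw [hvq, hqe, hur] at hcon
  exact lt_irrefl _ hcon

theorem exists_bound_of_le_log {C : ℝ} (hC : 0 ≤ C) :
    ∃ T, 1 ≤ T ∧ ∀ τ, 0 ≤ τ → τ ≤ C * Real.log (1 + 2 * τ) + 1 → τ ≤ T := by
  have hB : 1 ≤ 4 * (C + 1) := by linarith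
  have hlogB : 0 ≤ C * Real.log (4 * (C + 1)) := mul_nonneg hC (Real.log_nonneg hB)
  -- With `B = 4 (C + 1)`, the bound `log X ≤ X / B + log B` makes the right side at most `(1 + 2τ)
  -- / 4 + C log B + 1`, and half of `τ` is absorbed on the left.
  refine ⟨5 / 2 + 2 * (C * Real.log (4 * (C + 1))), by linarith, fun τ hτ h => ?_⟩
  have h1 : Real.log (1 + 2 * τ) ≤ (1 + 2 * τ) / (4 * (C + 1)) + Real.log (4 * (C + 1)) := by
    have := Real.log_le_sub_one_of_pos (x := (1 + 2 * τ) / (4 * (C + 1))) (by positivity)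
    rw [Real.log_div (by positivity) (by positivity)] at this
    linarith
  have h2 : C * ((1 + 2 * τ) / (4 * (C + 1))) ≤ (1 + 2 * τ) / 4 := by
    rw [← mul_div_assoc, div_le_div_iff₀ (by positivity) (by positivity)]
    nlinarith
  have h3 := mul_le_mul_of_nonneg_left h1 hC
  rw [mul_add] at h3
  linarith

/-- A Lipschitz weight whose integrals are controlled by the logarithmic metric. -/
structure IsLogControlled (δ : ℝ → ℝ) (L C : ℝ) : Prop extends IsLipWeight δ L where
  integral_le : ∀ s ∈ Icc 0 L, ∀ t ∈ Icc 0 L, s ≤ t →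
    ∫ u in s..t, 1 / δ u ≤ C * Real.log (1 + (t - s) / min (δ s) (δ t)) + 1

namespace IsLogControlled

variable {δ : ℝ → ℝ} {s t C T : ℝ}

theorem reverse (h : IsLogControlled δ L C) : IsLogControlled (fun u => δ (L - u)) L C where
  toIsLipWeight := h.toIsLipWeight.reverse
  integral_le s hs t ht hst := by
    have := h.integral_le (L - t) ⟨by linarith [ht.2], by linarith [ht.1]⟩ (L - s)
      ⟨by linarith [hs.2], by linarith [hs.1]⟩ (by linarith)
    rw [IsLipWeight.integral_reverse, min_comm]
    rwa [show L - s - (L - t) = t - s by ring] at this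

/-- With `τ = (t - s) / Δ`, the integral is at least `τ` because `δ ≤ Δ`, and at most `C log (1 +
2τ) + 1` because both end values are at least `Δ / 2`. This forces `τ ≤ T`. -/
theorem plateau (h : IsLogControlled δ L C) (hC : 0 ≤ C)
    (hT : ∀ τ, 0 ≤ τ → τ ≤ C * Real.log (1 + 2 * τ) + 1 → τ ≤ T) (hs : 0 ≤ s) (hst : s ≤ t)
    (ht : t ≤ L) {Δ : ℝ} (hΔ : ∀ u ∈ Icc s t, δ u ≤ Δ) (h1 : Δ / 2 ≤ δ s) (h2 : Δ / 2 ≤ δ t) :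
    t - s ≤ T * Δ ∧ ∫ u in s..t, 1 / δ u ≤ C * Real.log (1 + 2 * T) + 1 := by
  have hs' : s ∈ Icc 0 L := ⟨hs, hst.trans ht⟩
  have ht' : t ∈ Icc 0 L := ⟨hs.trans hst, ht⟩
  have hpos : 0 < Δ := (h.pos s hs').trans_le (hΔ s ⟨le_rfl, hst⟩)
  have hI := h.integral_le s hs' t ht' hst
  have hτ : 0 ≤ (t - s) / Δ := div_nonneg (by linarith) hpos.le
  have hle : ∫ u in s..t, 1 / δ u ≤ C * Real.log (1 + 2 * ((t - s) / Δ)) + 1 := by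
    have h3 : (t - s) / min (δ s) (δ t) ≤ 2 * ((t - s) / Δ) := by
      have : 2 * ((t - s) / Δ) = (t - s) / (Δ / 2) := by field_simp
      rw [this]
      exact div_le_div_of_nonneg_left (by linarith) (by linarith) (le_min h1 h2)
    have h4 : 0 ≤ (t - s) / min (δ s) (δ t) :=
      div_nonneg (by linarith) (le_min (h.pos s hs').le (h.pos t ht').le)
    have h5 : Real.log (1 + (t - s) / min (δ s) (δ t)) ≤ Real.log (1 + 2 * ((t - s) / Δ)) :=
      Real.log_le_log (by linarith) (by linarith)
    linarith [mul_le_mul_of_nonneg_left h5 hC]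
  have hτT := hT _ hτ ((h.div_le_integral hs hst ht hΔ).trans hle)
  refine ⟨(div_le_iff₀ hpos).1 hτT, hle.trans ?_⟩
  have := mul_le_mul_of_nonneg_left
      (Real.log_le_log (by linarith) (by linarith : 1 + 2 * ((t - s) / Δ) ≤ 1 + 2 * T)) hC
  linarith

/-- Induction on the number `k` of dyadic levels between `δ 0` and `δ q`; each level contributes one
plateau, and the lengths form a geometric series. -/
theorem le_of_isMax (h : IsLogControlled δ L C) (hC : 0 ≤ C) (hT1 : 1 ≤ T)
    (hT : ∀ τ, 0 ≤ τ → τ ≤ C * Real.log (1 + 2 * τ) + 1 → τ ≤ T) (k : ℕ) :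
    ∀ q ∈ Icc 0 L, (∀ u ∈ Icc 0 q, δ u ≤ δ q) → δ q ≤ 2 ^ k * δ 0 → q ≤ 2 * T * δ q := by
  have base : ∀ q ∈ Icc 0 L, (∀ u ∈ Icc 0 q, δ u ≤ δ q) → δ q / 2 ≤ δ 0 →
      q ≤ 2 * T * δ q := by
    intro q hq hmax h0
    have hp := h.pos q hq
    have := (h.plateau hC hT le_rfl hq.1 hq.2 hmax h0 (by linarith)).1
    nlinarith
  induction k with
  | zero =>
    intro q hq hmax hk
    exact base q hq hmax (by have := h.pos q hq; simp at hk; linarith)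
  | succ k ih =>
    intro q hq hmax hk
    have hp := h.pos q hq
    by_cases h0 : δ q / 2 ≤ δ 0
    · exact base q hq hmax h0
    · push Not at h0
      -- At the first `p` with `δ p = δ q / 2`, induction gives `p ≤ T δ q`, and the plateau from
      -- `p` to `q` adds at most `T δ q`.
      obtain ⟨p, hp1, hp2, hp3⟩ := exists_first_hit hq.1
        (h.continuousOn.mono (Icc_subset_Icc le_rfl hq.2)) h0.le (by linarith : δ q / 2 ≤ δ q)
      have h1 := ih p ⟨hp1.1, hp1.2.trans hq.2⟩ (fun u hu => by rw [hp2]; exact hp3 u hu)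
        (by rw [hp2]; rw [pow_succ] at hk; linarith)
      have h2 := (h.plateau hC hT hp1.1 hp1.2 hq.2
        (fun u hu => hmax u ⟨hp1.1.trans hu.1, hu.2⟩) hp2.ge (by linarith)).1
      rw [hp2] at h1
      nlinarith

/-- Before the global maximum, `δ` may dip at `s` only by a bounded factor below its running maximum
`δ q`: the dip lies in a plateau from `q` to the next return to level `δ q`, and the bounded
integral there controls both `δ q` and `s - q` by `δ s`. -/
theorem le_of_le_argmax (h : IsLogControlled δ L C) (hC : 0 ≤ C) (hT1 : 1 ≤ T)
    (hT : ∀ τ, 0 ≤ τ → τ ≤ C * Real.log (1 + 2 * τ) + 1 → τ ≤ T) {p : ℝ} (hp : p ∈ Icc 0 L)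
    (hmax : ∀ u ∈ Icc 0 L, δ u ≤ δ p) (hs : s ∈ Icc 0 p) :
    s ≤ (2 * T + 1) * Real.exp (C * Real.log (1 + 2 * T) + 1) * δ s := by
  have hsL : s ∈ Icc 0 L := ⟨hs.1, hs.2.trans hp.2⟩
  obtain ⟨q, hq, hqmax⟩ := isCompact_Icc.exists_isMaxOn (nonempty_Icc.2 hs.1)
    (h.continuousOn.mono (Icc_subset_Icc le_rfl hsL.2))
  have hqmax' : ∀ u ∈ Icc 0 s, δ u ≤ δ q := fun u hu => hqmax hu
  have hqL : q ∈ Icc 0 L := ⟨hq.1, hq.2.trans hsL.2⟩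
  have hq0 := h.pos q hqL
  obtain ⟨p', hp1, hp2, hp3⟩ := exists_first_hit hs.2
    (h.continuousOn.mono (Icc_subset_Icc hs.1 hp.2)) (hqmax' s ⟨hs.1, le_rfl⟩) (hmax q hqL)
  obtain ⟨k, hk⟩ := pow_unbounded_of_one_lt (δ q / δ 0) (one_lt_two)
  have h1 : q ≤ 2 * T * δ q := h.le_of_isMax hC hT1 hT k q hqL
    (fun u hu => hqmax' u ⟨hu.1, hu.2.trans hq.2⟩)
    ((div_lt_iff₀ (h.pos 0 ⟨le_rfl, h.nonneg⟩)).1 hk).le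
  have h2 := (h.plateau hC hT hq.1 (hq.2.trans hp1.1) (hp1.2.trans hp.2) (Δ := δ q)
    (fun u hu => (le_total u s).elim (fun hus => hqmax' u ⟨hq.1.trans hu.1, hus⟩)
      fun hus => hp3 u ⟨hus, hu.2⟩) (by linarith) (by linarith)).2
  have h3 := (h.integral_mono_interval hq.1 le_rfl hq.2 hp1.1 (hp1.2.trans hp.2)).trans h2
  have h4 := (h.add_le_mul_exp_right hq.1 hq.2 hsL.2).trans
    (mul_le_mul_of_nonneg_left (Real.exp_le_exp.2 h3) (h.pos s hsL).le)
  have h5 := (abs_le.1 (h.lip q hqL s hsL)).2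
  rw [abs_of_nonpos (by linarith [hq.2])] at h5
  have h6 := h.pos s hsL
  set e := Real.exp (C * Real.log (1 + 2 * T) + 1)
  have h7 : δ q ≤ δ s * e := by linarith
  have h8 : s - q ≤ δ s * e := by linarith
  have h9 : 2 * T * δ q ≤ 2 * T * (δ s * e) := mul_le_mul_of_nonneg_left h7 (by linarith)
  calc s = q + (s - q) := by ring
    _ ≤ 2 * T * (δ s * e) + δ s * e := by linarith
    _ = _ := by ring

end IsLogControlled

theorem exists_uniform_const {C : ℝ} (hC : 0 ≤ C) : ∃ A, 1 ≤ A ∧ ∀ (δ : ℝ → ℝ) (L : ℝ),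
    IsLogControlled δ L C → ∀ s ∈ Icc 0 L, min s (L - s) ≤ A * δ s := by
  obtain ⟨T, hT1, hT⟩ := exists_bound_of_le_log hC
  have he : 1 ≤ Real.exp (C * Real.log (1 + 2 * T) + 1) :=
    Real.one_le_exp (add_nonneg (mul_nonneg hC (Real.log_nonneg (by linarith))) one_pos.le)
  refine ⟨(2 * T + 1) * Real.exp (C * Real.log (1 + 2 * T) + 1), by nlinarith, ?_⟩
  intro δ L h s hs
  obtain ⟨p, hp, hmax⟩ := isCompact_Icc.exists_isMaxOn (nonempty_Icc.2 h.nonneg) h.continuousOn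
  have hmax' : ∀ u ∈ Icc 0 L, δ u ≤ δ p := fun u hu => hmax hu
  rcases le_total s p with hsp | hsp
  · exact (min_le_left _ _).trans (h.le_of_le_argmax hC hT1 hT hp hmax' ⟨hs.1, hsp⟩)
  · refine (min_le_right _ _).trans ?_
    have := h.reverse.le_of_le_argmax hC hT1 hT (p := L - p) (s := L - s)
      ⟨by linarith [hp.2], by linarith [hp.1]⟩
      (fun u hu => by
        simpa using hmax' (L - u) ⟨by linarith [hu.2], by linarith [hu.1]⟩)
      ⟨by linarith [hs.2], by linarith⟩
    simpa using this

end RealAnalysis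

end

/-! ### From A-uniformity to inner uniformity and the bound on `j'` -/

section

variable {n : ℕ} {D : Set (E n)} {x y z : E n} {L M C c : ℝ} {g h : ℝ → E n}

section ApollonianBound

theorem eq_infty_or_mem_frontier_of_mem_extBoundary {a : OnePoint (E n)}
    (ha : a ∈ extBoundary D) : a = OnePoint.infty ∨ ∃ p ∈ frontier D, a = (p : OnePoint (E n)) := by
  induction a using OnePoint.rec with
  | infty => exact Or.inl rfl
  | coe p =>
    refine Or.inr ⟨p, ?_, rfl⟩
    have h1 := (OnePoint.isOpenEmbedding_coe (X := E n)).isOpenMap.preimage_frontier_eq_frontier_preimage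
      OnePoint.continuous_coe ((fun x : E n => (x : OnePoint (E n))) '' D)
    rw [preimage_image_eq _ OnePoint.coe_injective] at h1
    rw [← h1]
    exact ha

theorem distQuot_pos_and_le (hO : IsOpen D) (hF : (frontier D).Nonempty) (hx : x ∈ D)
    (hy : y ∈ D) {a : OnePoint (E n)} (ha : a ∈ extBoundary D) :
    0 < distQuot a x y ∧ distQuot a x y ≤ 1 + dist x y / bdryDist D y := by
  have hdy := bdryDist_pos hO hF hy
  rcases eq_infty_or_mem_frontier_of_mem_extBoundary ha with rfl | ⟨p, hp, rfl⟩
  · have : distQuot OnePoint.infty x y = 1 := rfl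
    rw [this]
    exact ⟨one_pos, by have : 0 ≤ dist x y / bdryDist D y := by positivity
                       linarith⟩
  · have : distQuot (p : OnePoint (E n)) x y = dist p x / dist p y := rfl
    rw [this]
    have hpx : bdryDist D x ≤ dist p x := by
      rw [dist_comm]; exact Metric.infDist_le_dist_of_mem hp
    have hpy : bdryDist D y ≤ dist p y := by
      rw [dist_comm]; exact Metric.infDist_le_dist_of_mem hp
    have hdx := bdryDist_pos hO hF hx
    have h1 : 0 < dist p y := hdy.trans_le hpy
    refine ⟨div_pos (hdx.trans_le hpx) h1, ?_⟩
    have h2 : dist p x ≤ dist p y + dist x y := by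
      rw [dist_comm x y]; exact dist_triangle _ _ _
    calc dist p x / dist p y ≤ (dist p y + dist x y) / dist p y := by gcongr
      _ = 1 + dist x y / dist p y := by rw [add_div, div_self h1.ne']
      _ ≤ _ := by gcongr

theorem apollonianDist_le (hO : IsOpen D) (hF : (frontier D).Nonempty) (hx : x ∈ D)
    (hy : y ∈ D) :
    apollonianDist D x y ≤ 2 * Real.log (1 + dist x y / min (bdryDist D x) (bdryDist D y)) := by
  have hdx := bdryDist_pos hO hF hx
  have hdy := bdryDist_pos hO hF hy
  have hm : 0 < min (bdryDist D x) (bdryDist D y) := lt_min hdx hdy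
  have hq : 0 ≤ dist x y / min (bdryDist D x) (bdryDist D y) := by positivity
  -- The nonnegativity of the bound covers the default value of the supremum of an empty set.
  refine Real.sSup_le ?_ (mul_nonneg two_pos.le (Real.log_nonneg (by linarith)))
  rintro _ ⟨a, ha, b, hb, rfl⟩
  obtain ⟨ha0, ha1⟩ := distQuot_pos_and_le hO hF hx hy ha
  obtain ⟨hb0, hb1⟩ := distQuot_pos_and_le hO hF hy hx hb
  rw [dist_comm y x] at hb1
  rw [Real.log_mul ha0.ne' hb0.ne', two_mul]
  refine add_le_add (Real.log_le_log ha0 (ha1.trans ?_)) (Real.log_le_log hb0 (hb1.trans ?_))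
  · gcongr
    exact min_le_right _ _
  · gcongr
    exact min_le_left _ _

end ApollonianBound

theorem IsLipCurve.isLipWeight (hO : IsOpen D) (hF : (frontier D).Nonempty)
    (hg : IsLipCurve D x y L g) : IsLipWeight (fun u => bdryDist D (g u)) L where
  nonneg := hg.nonneg
  pos s hs := bdryDist_pos hO hF (hg.mem s hs)
  lip s hs t ht := (abs_bdryDist_sub_le D _ _).trans (hg.lip s hs t ht)

theorem IsUnitCurve.integral_trans (hO : IsOpen D) (hF : (frontier D).Nonempty)
    (hg : IsUnitCurve D x y L g) (hh : IsUnitCurve D y z M h) :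
    ∫ u in (0 : ℝ)..(L + M), 1 / bdryDist D ((fun u => if u ≤ L then g u else h (u - L)) u) =
      (∫ u in (0 : ℝ)..L, 1 / bdryDist D (g u)) + ∫ u in (0 : ℝ)..M, 1 / bdryDist D (h u) := by
  have hL := hg.nonneg
  have hM := hh.nonneg
  have hw := (hg.trans hh).isLipCurve.isLipWeight hO hF
  rw [← intervalIntegral.integral_add_adjacent_intervals
    (hw.intervalIntegrable le_rfl hL (by linarith))
    (hw.intervalIntegrable hL (by linarith) le_rfl)]
  congr 1
  · refine intervalIntegral.integral_congr fun u hu => ?_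
    rw [uIcc_of_le hL] at hu
    simp only [if_pos hu.2]
  · have h1 : ∫ u in L..(L + M), 1 / bdryDist D (h (u - L)) =
        ∫ u in (0 : ℝ)..M, 1 / bdryDist D (h u) := by
      rw [intervalIntegral.integral_comp_sub_right (fun u => 1 / bdryDist D (h u))]
      simp
    rw [← h1]
    refine intervalIntegral.integral_congr fun u hu => ?_
    rw [uIcc_of_le (by linarith)] at hu
    rcases hu.1.eq_or_lt with h0 | h0
    · subst h0
      simp [hg.right, hh.left]
    · simp only [if_neg (not_le.2 h0)]

/-- No exact geodesic is needed. A curve within 1 of the infimum has the same excess bound on every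
subarc, since replacing a subarc by a competitor yields a curve from `x` to `y` again. -/
theorem exists_near_geodesic (hO : IsOpen D) (hF : (frontier D).Nonempty)
    (hc : IsPreconnected D) (hx : x ∈ D) (hy : y ∈ D) :
    ∃ L g, IsUnitCurve D x y L g ∧ ∀ s ∈ Icc 0 L, ∀ t ∈ Icc 0 L, s ≤ t →
      ∫ u in s..t, 1 / bdryDist D (g u) ≤ quasihyperbolicDist D (g s) (g t) + 1 := by
  obtain ⟨L, g, hg, hlt⟩ := exists_unitCurve_integral_lt hO hF hc hx hy one_pos
  refine ⟨L, g, hg, fun s hs t ht hst => ?_⟩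
  have hw := hg.isLipCurve.isLipWeight hO hF
  rw [← sub_le_iff_le_add]
  refine le_quasihyperbolicDist hO hF hc (hg.mem s hs) (hg.mem t ht) fun M h hh => ?_
  have h1 := hg.restrict le_rfl hs.1 hs.2
  have h2 := hg.restrict ht.1 ht.2 le_rfl
  have h3 := quasihyperbolicDist_le ((h1.trans hh).trans h2)
  rw [(h1.trans hh).integral_trans hO hF h2, h1.integral_trans hO hF hh, hg.left, hg.right] at h3
  have h4 : ∫ u in (0 : ℝ)..(s - 0), 1 / bdryDist D (g (0 + u)) =
      ∫ u in (0 : ℝ)..s, 1 / bdryDist D (g u) := by simp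
  have h5 : ∫ u in (0 : ℝ)..(L - t), 1 / bdryDist D (g (t + u)) =
      ∫ u in t..L, 1 / bdryDist D (g u) := by
    rw [intervalIntegral.integral_comp_add_left (fun u => 1 / bdryDist D (g u))]
    simp
  rw [h4, h5] at h3
  have h6 := intervalIntegral.integral_add_adjacent_intervals
    (hw.intervalIntegrable le_rfl hs.1 hs.2) (hw.intervalIntegrable hs.1 hst ht.2)
  have h7 := intervalIntegral.integral_add_adjacent_intervals
    (hw.intervalIntegrable le_rfl ht.1 ht.2) (hw.intervalIntegrable ht.1 ht.2 le_rfl)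
  linarith

/-- If the quasihyperbolic metric is controlled by the logarithmic distance ratio metric, any two
points are joined by a curve satisfying the (Euclidean) uniformity conditions. -/
theorem exists_uniform_curve (hC : 0 ≤ C) : ∃ c, 1 ≤ c ∧ ∀ D : Set (E n), IsOpen D →
    (frontier D).Nonempty → IsPreconnected D →
    (∀ x ∈ D, ∀ y ∈ D, quasihyperbolicDist D x y ≤
      C * Real.log (1 + dist x y / min (bdryDist D x) (bdryDist D y))) →
    ∀ x ∈ D, ∀ y ∈ D, ∃ L g, IsLipCurve D x y L g ∧ L ≤ c * dist x y ∧
      ∀ s ∈ Icc 0 L, min s (L - s) ≤ c * bdryDist D (g s) := by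
  obtain ⟨A, hA1, hA⟩ := exists_uniform_const hC
  set M := C * Real.log (1 + 3 * A) + 1 with hM
  have hexp := Real.exp_pos M
  have hAc : A ≤ A + 2 + 3 * Real.exp M := by linarith
  refine ⟨A + 2 + 3 * Real.exp M, by linarith, fun D hO hF hc hk x hx y hy => ?_⟩
  have hseg : ∀ x ∈ D, ∀ y ∈ D, 2 * dist x y ≤ bdryDist D x → ∃ L g, IsLipCurve D x y L g ∧
      L ≤ (A + 2 + 3 * Real.exp M) * dist x y ∧
      ∀ s ∈ Icc 0 L, min s (L - s) ≤ (A + 2 + 3 * Real.exp M) * bdryDist D (g s) := by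
    intro x hx y hy hxy
    have hdx := bdryDist_pos hO hF hx
    obtain ⟨g, hg⟩ := exists_unitCurve_of_dist_lt (y := y) hO hx (by linarith)
    refine ⟨_, g, hg.isLipCurve, by nlinarith [dist_nonneg (x := x) (y := y)], fun s hs => ?_⟩
    -- Along the segment `d(g s) ≥ d(x) - s ≥ s`, because `d(x) ≥ 2 |x - y| ≥ 2 s`.
    have h1 := bdryDist_le_add D x (g s)
    have h2 := hg.isLipCurve.lip 0 ⟨le_rfl, hg.nonneg⟩ s hs
    rw [hg.left, zero_sub, abs_neg, abs_of_nonneg hs.1] at h2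
    have h3 := bdryDist_nonneg D (g s)
    refine (min_le_left _ _).trans ?_
    nlinarith [hs.2]
  by_cases h1 : 2 * dist x y ≤ bdryDist D x
  · exact hseg x hx y hy h1
  by_cases h2 : 2 * dist x y ≤ bdryDist D y
  · rw [dist_comm] at h2
    obtain ⟨L, g, hg, hL, hs⟩ := hseg y hy x hx h2
    refine ⟨L, _, hg.reverse, by rwa [dist_comm], fun s hs' => ?_⟩
    have := hs (L - s) ⟨by linarith [hs'.2], by linarith [hs'.1]⟩
    rwa [sub_sub_cancel, min_comm] at this
  push Not at h1 h2
  have hR : 0 < dist x y := by linarith [bdryDist_pos hO hF hx]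
  obtain ⟨L, g, hg, hint⟩ := exists_near_geodesic hO hF hc hx hy
  have hl := hg.isLipCurve
  have hw := hl.isLipWeight hO hF
  have hint' : ∀ s ∈ Icc 0 L, ∀ t ∈ Icc 0 L, s ≤ t → ∀ r, dist (g s) (g t) ≤ r → ∀ m, 0 < m →
      m ≤ min (bdryDist D (g s)) (bdryDist D (g t)) →
      ∫ u in s..t, 1 / bdryDist D (g u) ≤ C * Real.log (1 + r / m) + 1 := by
    intro s hs t ht hst r hr m hm0 hm
    have hq : 0 ≤ dist (g s) (g t) / min (bdryDist D (g s)) (bdryDist D (g t)) :=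
      div_nonneg dist_nonneg (hm0.le.trans hm)
    have h3 : dist (g s) (g t) / min (bdryDist D (g s)) (bdryDist D (g t)) ≤ r / m :=
      div_le_div₀ (dist_nonneg.trans hr) hr hm0 hm
    have h4 : Real.log (1 + dist (g s) (g t) / min (bdryDist D (g s)) (bdryDist D (g t))) ≤
        Real.log (1 + r / m) := Real.log_le_log (by linarith) (by linarith)
    linarith [hint s hs t ht hst, hk _ (hg.mem s hs) _ (hg.mem t ht),
      mul_le_mul_of_nonneg_left h4 hC]
  have hctrl : IsLogControlled (fun u => bdryDist D (g u)) L C :=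
    { hw with
      integral_le := fun s hs t ht hst => hint' s hs t ht hst (t - s)
        (by have := hl.lip s hs t ht; rwa [abs_of_nonpos (by linarith), neg_sub] at this) _
        (lt_min (hw.pos s hs) (hw.pos t ht)) le_rfl }
  have hmin := hA _ L hctrl
  refine ⟨L, g, hl, ?_, fun s hs => (hmin s hs).trans
    (mul_le_mul_of_nonneg_right hAc (bdryDist_nonneg _ _))⟩
  -- For a long curve, cut off length `R = |x - y|` at each end. The cigar condition gives `d ≥ R /
  -- A` at the two cut points, which are at most `3R` apart, so the middle piece has quasihyperbolic
  -- length at most `M` and hence Euclidean length at most `3R exp M`.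
  rcases le_total L (2 * dist x y) with hL | hL
  · nlinarith
  set R := dist x y with hRdef
  have hs : R ∈ Icc 0 L := ⟨hR.le, by linarith⟩
  have ht : L - R ∈ Icc 0 L := ⟨by linarith, by linarith⟩
  have hs1 := hmin R hs
  rw [min_eq_left (by linarith)] at hs1
  have ht1 := hmin (L - R) ht
  rw [sub_sub_cancel, min_eq_right (by linarith)] at ht1
  have hxs := hl.lip 0 ⟨le_rfl, hg.nonneg⟩ R hs
  rw [hg.left, zero_sub, abs_neg, abs_of_pos hR] at hxs
  have hty := hl.lip (L - R) ht L ⟨hg.nonneg, le_rfl⟩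
  rw [hg.right, sub_sub_cancel_left, abs_neg, abs_of_pos hR] at hty
  have hst : dist (g R) (g (L - R)) ≤ 3 * R := by
    have h3 := dist_triangle (g R) x (g (L - R))
    have h4 := dist_triangle x y (g (L - R))
    rw [dist_comm (g R) x] at h3
    rw [dist_comm y] at h4
    linarith
  have hI := hint' R hs (L - R) ht (by linarith) _ hst (R / A) (by positivity)
    (le_min ((div_le_iff₀' (by linarith)).2 hs1) ((div_le_iff₀' (by linarith)).2 ht1))
  rw [show 3 * R / (R / A) = 3 * A by field_simp, ← hM] at hI
  have h5 := hw.add_le_mul_exp_left hR.le (by linarith : R ≤ L - R) ht.2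
  have h6 : bdryDist D (g R) ≤ 3 * R := by
    have := bdryDist_le_add D (g R) x
    rw [dist_comm] at this
    linarith
  have h7 : bdryDist D (g R) * Real.exp (∫ u in R..(L - R), 1 / bdryDist D (g u)) ≤
      3 * R * Real.exp M :=
    mul_le_mul h6 (Real.exp_le_exp.2 hI) (Real.exp_pos _).le (by linarith)
  have h8 := bdryDist_nonneg D (g R)
  nlinarith

theorem ofReal_dist_le_pathLength (γ : Path x y) : ENNReal.ofReal (dist x y) ≤ pathLength γ := by
  rw [← edist_dist]
  have := eVariationOn.edist_le γ (mem_univ 0) (mem_univ 1)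
  rwa [γ.source, γ.target] at this

theorem ofReal_dist_le_innerLengthDist (D : Set (E n)) (x y : E n) :
    ENNReal.ofReal (dist x y) ≤ innerLengthDist D x y := by
  refine le_sInf ?_
  rintro _ ⟨γ, -, -, rfl⟩
  exact ofReal_dist_le_pathLength γ

/-- Euclidean distance is at most `λ_D`, so the Euclidean length bound is stronger than the inner
one. -/
theorem isInnerUniform_of_curves (hc : 0 < c)
    (h : ∀ x ∈ D, ∀ y ∈ D, ∃ L g, IsLipCurve D x y L g ∧ L ≤ c * dist x y ∧
      ∀ s ∈ Icc 0 L, min s (L - s) ≤ c * bdryDist D (g s)) : IsInnerUniform D c := by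
  refine ⟨hc, fun x hx y hy => ?_⟩
  obtain ⟨L, g, hg, hL, hs⟩ := h x hx y hy
  obtain ⟨γ, h1, h2, h3, h4⟩ := hg.exists_arc (f := fun z => c * bdryDist D z) hs
  refine ⟨γ, h1, h2, (h3.trans_lt ENNReal.ofReal_lt_top).ne, h4, h3.trans ?_⟩
  refine (ENNReal.ofReal_le_ofReal hL).trans ?_
  rw [ENNReal.ofReal_mul hc.le]
  gcongr
  exact ofReal_dist_le_innerLengthDist D x y

theorem innerDiamDist_le_of_arc {γ : Path x y} (hγ : IsArc γ) (hD : range γ ⊆ D)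
    (hL : pathLength γ ≤ ENNReal.ofReal L) (hL0 : 0 ≤ L) : innerDiamDist D x y ≤ L := by
  refine (csInf_le ⟨0, ?_⟩ ⟨γ, hγ, hD, rfl⟩ : innerDiamDist D x y ≤ Metric.diam (range γ)).trans ?_
  · rintro _ ⟨γ', -, -, rfl⟩
    exact Metric.diam_nonneg
  · refine Metric.diam_le_of_forall_dist_le hL0 ?_
    rintro _ ⟨s, rfl⟩ _ ⟨t, rfl⟩
    have := (eVariationOn.edist_le γ (mem_univ s) (mem_univ t)).trans hL
    rwa [edist_dist, ENNReal.ofReal_le_ofReal_iff hL0] at this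

/-- Bernoulli's inequality. -/
theorem log_one_add_mul_le (hc : 1 ≤ c) {a : ℝ} (ha : 0 ≤ a) :
    Real.log (1 + c * a) ≤ c * Real.log (1 + a) := by
  rw [← Real.log_rpow (by linarith)]
  exact Real.log_le_log (by nlinarith) (one_add_mul_self_le_rpow_one_add (by linarith) hc)

theorem IsLipWeight.log_le_integral_min {δ : ℝ → ℝ} (h : IsLipWeight δ L) :
    Real.log (1 + L / min (δ 0) (δ L)) ≤ ∫ u in (0 : ℝ)..L, 1 / δ u := by
  rcases min_choice (δ 0) (δ L) with h0 | h0 <;> rw [h0]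
  · simpa using h.log_le_integral_left le_rfl h.nonneg le_rfl
  · simpa using h.log_le_integral_right le_rfl h.nonneg le_rfl

theorem jPrime_le_quasihyperbolicDist (hO : IsOpen D) (hF : (frontier D).Nonempty)
    (hpc : IsPreconnected D) (hc : 1 ≤ c) (hD : IsInnerUniform D c) (hx : x ∈ D) (hy : y ∈ D) :
    jPrime D x y ≤ c * quasihyperbolicDist D x y := by
  have hc0 : 0 < c := by linarith
  rw [← div_le_iff₀' hc0]
  refine le_quasihyperbolicDist hO hF hpc hx hy fun L g hg => ?_
  rw [div_le_iff₀' hc0]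
  obtain ⟨γ, h1, h2, -, -, h5⟩ := hD.2 x hx y hy
  have hlen : pathLength γ ≤ ENNReal.ofReal (c * L) := by
    rw [ENNReal.ofReal_mul hc0.le]
    refine h5.trans ?_
    gcongr
    exact hg.isLipCurve.innerLengthDist_le
  have hρ := innerDiamDist_le_of_arc h1 h2 hlen (mul_nonneg hc0.le hg.nonneg)
  have hρ0 : 0 ≤ innerDiamDist D x y := by
    refine Real.sInf_nonneg ?_
    rintro _ ⟨γ', -, -, rfl⟩
    exact Metric.diam_nonneg
  have hm : 0 < min (bdryDist D x) (bdryDist D y) :=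
    lt_min (bdryDist_pos hO hF hx) (bdryDist_pos hO hF hy)
  have hlog := (hg.isLipCurve.isLipWeight hO hF).log_le_integral_min
  simp only [hg.left, hg.right] at hlog
  refine le_trans ?_ (mul_le_mul_of_nonneg_left hlog hc0.le)
  refine le_trans ?_ (log_one_add_mul_le hc (div_nonneg hg.nonneg hm.le))
  have hq : 0 ≤ innerDiamDist D x y / min (bdryDist D x) (bdryDist D y) := div_nonneg hρ0 hm.le
  refine Real.log_le_log (by linarith) ?_
  rw [← mul_div_assoc]
  gcongr

theorem isInnerUniform_and_jPrime_le_of_isAUniform {K : ℝ} (hn : 2 ≤ n) (hK : 0 < K) :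
    ∃ c μ : ℝ, 0 < c ∧ 0 < μ ∧ ∀ D : Set (E n), IsApollonianDomain D → IsAUniform D K →
      IsInnerUniform D c ∧ ∀ x ∈ D, ∀ y ∈ D, jPrime D x y ≤ μ * apollonianDist D x y := by
  -- The factor 2 is the one in `apollonianDist_le`.
  obtain ⟨c, hc1, hc⟩ := exists_uniform_curve (n := n) (C := K * 2) (by linarith)
  have hc0 : 0 < c := by linarith
  refine ⟨c, c * K, hc0, mul_pos hc0 hK, fun D hD hA => ?_⟩
  have hF := hD.frontier_nonempty hn
  have hU : IsInnerUniform D c := isInnerUniform_of_curves hc0 <|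
    hc D hD.isOpen hF hD.isConnected.isPreconnected fun x hx y hy => by
      refine (hA x hx y hy).trans ?_
      rw [mul_assoc]
      exact mul_le_mul_of_nonneg_left (apollonianDist_le hD.isOpen hF hx hy) hK.le
  refine ⟨hU, fun x hx y hy => ?_⟩
  refine (jPrime_le_quasihyperbolicDist hD.isOpen hF hD.isConnected.isPreconnected hc1 hU
    hx hy).trans ?_
  rw [mul_assoc]
  exact mul_le_mul_of_nonneg_left (hA x hx y hy) hc0.le

end

/-! ### From inner uniformity and the bound on `j'` to A-uniformity -/

section

variable {n : ℕ} {D : Set (E n)} {x y z : E n} {L M c : ℝ} {g h : ℝ → E n}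

theorem IsInnerUniform.exists_curve (hD : IsInnerUniform D c) (hx : x ∈ D) (hy : y ∈ D) :
    ∃ L g, IsUnitCurve D x y L g ∧ (∀ s ∈ Icc 0 L, min s (L - s) ≤ c * bdryDist D (g s)) ∧
      ∀ M h, IsLipCurve D x y M h → L ≤ c * M := by
  obtain ⟨γ, -, h2, h3, h4, h5⟩ := hD.2 x hx y hy
  have hc := hD.1
  refine ⟨_, _, isUnitCurve_naturalParameterization γ h2 h3, fun s hs => ?_, fun M h hh => ?_⟩
  · obtain ⟨t, ht1, ht2, ht3⟩ := exists_naturalParameterization_eq γ h3 hs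
    have := h4 t
    rw [ht2, ht3, ← ENNReal.ofReal_min,
      ENNReal.ofReal_le_ofReal_iff (mul_nonneg hc.le (bdryDist_nonneg D _)), ← ht1] at this
    exact this
  · refine ENNReal.toReal_le_of_le_ofReal (mul_nonneg hc.le hh.nonneg) (h5.trans ?_)
    rw [ENNReal.ofReal_mul hc.le]
    gcongr
    exact hh.innerLengthDist_le

namespace IsLipWeight

variable {δ : ℝ → ℝ}

/-- On the first half `u ≤ c δ u`, and always `δ 0 ≤ δ u + u`; together `u + δ 0 ≤ (2c + 1) δ u`,
which integrates to a logarithm. -/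
theorem integral_half_le (hw : IsLipWeight δ L) (hc : 0 < c)
    (h : ∀ s ∈ Icc 0 L, min s (L - s) ≤ c * δ s) :
    ∫ u in (0 : ℝ)..(L / 2), 1 / δ u ≤ (2 * c + 1) * Real.log (1 + L / δ 0) := by
  have hL := hw.nonneg
  have h0 := hw.pos 0 ⟨le_rfl, hL⟩
  have h1 : ∫ u in (0 : ℝ)..(L / 2), (2 * c + 1) * (1 / (u + δ 0)) =
      (2 * c + 1) * Real.log (1 + L / 2 / δ 0) := by
    rw [intervalIntegral.integral_const_mul,
      intervalIntegral.integral_comp_add_right (fun u => 1 / u),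
      integral_one_div_of_pos (by linarith) (by linarith), zero_add, add_comm (L / 2), add_div,
      div_self h0.ne']
  have h2 : Real.log (1 + L / 2 / δ 0) ≤ Real.log (1 + L / δ 0) := by
    refine Real.log_le_log (by positivity) ?_
    gcongr
    linarith
  refine le_trans ?_ (mul_le_mul_of_nonneg_left h2 (by linarith))
  rw [← h1]
  refine intervalIntegral.integral_mono_on (by linarith)
    (hw.intervalIntegrable le_rfl (by linarith) (by linarith)) ?_ fun u hu => ?_
  · apply ContinuousOn.intervalIntegrable
    rw [uIcc_of_le (by linarith)]
    exact continuousOn_const.mul (continuousOn_const.div (by fun_prop)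
      fun u hu => by linarith [hu.1])
  · have hu' : u ∈ Icc 0 L := ⟨hu.1, by linarith [hu.2]⟩
    have h3 := h u hu'
    rw [min_eq_left (by linarith [hu.2])] at h3
    have h4 := (abs_le.1 (hw.lip 0 ⟨le_rfl, hL⟩ u hu')).2
    rw [zero_sub, abs_neg, abs_of_nonneg hu.1] at h4
    rw [mul_one_div, div_le_div_iff₀ (hw.pos u hu') (by linarith [hu.1])]
    linarith

theorem integral_le_log (hw : IsLipWeight δ L) (hc : 0 < c)
    (h : ∀ s ∈ Icc 0 L, min s (L - s) ≤ c * δ s) :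
    ∫ u in (0 : ℝ)..L, 1 / δ u ≤
      2 * (2 * c + 1) * Real.log (1 + L / min (δ 0) (δ L)) := by
  have hL := hw.nonneg
  have h0 := hw.pos 0 ⟨le_rfl, hL⟩
  have h1 := hw.pos L ⟨hL, le_rfl⟩
  have hm : 0 < min (δ 0) (δ L) := lt_min h0 h1
  have hA := hw.integral_half_le hc h
  have hB := hw.reverse.integral_half_le hc fun s hs => by
    have := h (L - s) ⟨by linarith [hs.2], by linarith [hs.1]⟩
    rwa [sub_sub_cancel, min_comm] at this
  rw [integral_reverse, sub_zero, show L - L / 2 = L / 2 by ring] at hB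
  have hA' : Real.log (1 + L / δ 0) ≤ Real.log (1 + L / min (δ 0) (δ L)) := by
    refine Real.log_le_log (by positivity) ?_
    gcongr
    exact min_le_left _ _
  have hB' : Real.log (1 + L / δ L) ≤ Real.log (1 + L / min (δ 0) (δ L)) := by
    refine Real.log_le_log (by positivity) ?_
    gcongr
    exact min_le_right _ _
  rw [← intervalIntegral.integral_add_adjacent_intervals
    (hw.intervalIntegrable le_rfl (by linarith : 0 ≤ L / 2) (by linarith))
    (hw.intervalIntegrable (by linarith) (by linarith : L / 2 ≤ L) le_rfl)]
  have hc' : 0 ≤ 2 * c + 1 := by linarith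
  linarith [mul_le_mul_of_nonneg_left hA' hc', mul_le_mul_of_nonneg_left hB' hc']

end IsLipWeight

/-- The inner length metric, computed with Lipschitz curves and real valued. -/
noncomputable def lipDist (D : Set (E n)) (x y : E n) : ℝ := sInf {L | ∃ g, IsLipCurve D x y L g}

theorem IsLipCurve.lipDist_le (hg : IsLipCurve D x y L g) : lipDist D x y ≤ L :=
  csInf_le ⟨0, by rintro _ ⟨g, hg⟩; exact hg.nonneg⟩ ⟨g, hg⟩

theorem lipDist_comm (D : Set (E n)) (x y : E n) : lipDist D x y = lipDist D y x := by
  rw [lipDist, lipDist]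
  congr 1
  ext L
  exact ⟨fun ⟨_, hg⟩ => ⟨_, hg.reverse⟩, fun ⟨_, hg⟩ => ⟨_, hg.reverse⟩⟩

theorem lipDist_self (hx : x ∈ D) : lipDist D x x = 0 := by
  have h : IsLipCurve D x x 0 (fun _ => x) :=
    ⟨le_rfl, by simp, rfl, rfl, fun _ _ => hx⟩
  refine le_antisymm h.lipDist_le (Real.sInf_nonneg ?_)
  rintro _ ⟨g, hg⟩
  exact hg.nonneg

/-- Any two points of `D` are joined by a Lipschitz curve. -/
def IsLipConnected (D : Set (E n)) : Prop := ∀ x ∈ D, ∀ y ∈ D, ∃ L g, IsLipCurve D x y L g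

theorem le_lipDist (hD : IsLipConnected D) (hx : x ∈ D) (hy : y ∈ D) {b : ℝ}
    (h : ∀ L g, IsLipCurve D x y L g → b ≤ L) : b ≤ lipDist D x y := by
  obtain ⟨L, g, hg⟩ := hD x hx y hy
  refine le_csInf ⟨L, g, hg⟩ ?_
  rintro L ⟨g, hg⟩
  exact h L g hg

theorem lipDist_triangle (hD : IsLipConnected D) (hx : x ∈ D) (hy : y ∈ D) (hz : z ∈ D) :
    lipDist D x z ≤ lipDist D x y + lipDist D y z := by
  rw [← sub_le_iff_le_add]
  refine le_lipDist hD hx hy fun L g hg => ?_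
  rw [sub_le_comm]
  refine le_lipDist hD hy hz fun M h hh => ?_
  rw [sub_le_iff_le_add']
  exact (hg.trans hh).lipDist_le

theorem lipDist_le_dist (hO : IsOpen D) (hx : x ∈ D) (h : dist x y < bdryDist D x) :
    lipDist D x y ≤ dist x y := by
  obtain ⟨g, hg⟩ := exists_unitCurve_of_dist_lt hO hx h
  exact hg.isLipCurve.lipDist_le

theorem abs_lipDist_sub_le (hD : IsLipConnected D) (hx : x ∈ D) (hy : y ∈ D) (hz : z ∈ D) :
    |lipDist D x y - lipDist D x z| ≤ lipDist D y z := by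
  have h1 := lipDist_triangle hD hx hy hz
  have h2 := lipDist_triangle hD hx hz hy
  rw [lipDist_comm D z y] at h2
  exact abs_le.2 ⟨by linarith, by linarith⟩

theorem continuousOn_lipDist (hO : IsOpen D) (hF : (frontier D).Nonempty) (hD : IsLipConnected D)
    (hx : x ∈ D) : ContinuousOn (lipDist D x) D := by
  rw [Metric.continuousOn_iff]
  intro b hb ε hε
  refine ⟨min ε (bdryDist D b), lt_min hε (bdryDist_pos hO hF hb), fun a ha hab => ?_⟩
  have h1 := lipDist_le_dist hO hb
    (by rw [dist_comm]; exact hab.trans_le (min_le_right _ _) : dist b a < bdryDist D b)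
  have h2 := abs_lipDist_sub_le hD hx hb ha
  rw [dist_comm, Real.dist_eq]
  rw [dist_comm] at h1
  linarith [hab.trans_le (min_le_left _ _)]

/-- A set of diameter comparable to `r` contains a bounded number of points which are
`r / c`-separated. -/
theorem exists_card_bound_of_separated (n : ℕ) (hc : 0 < c) :
    ∃ N : ℕ, ∀ (r : ℝ) (p : E n) (m : ℕ) (w : Fin m → E n), 0 < r → (∀ i, dist (w i) p ≤ 2 * r) →
      (∀ i j, i ≠ j → r / c ≤ dist (w i) (w j)) → m ≤ N := by
  -- After rescaling by `1 / r`, points in the same ball of radius `1 / (2c)` are less than `1 / c`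
  -- apart, so the points occupy distinct balls of a finite cover.
  obtain ⟨F, hF, hcov⟩ := Metric.totallyBounded_iff.1
    (isCompact_closedBall (0 : E n) 2).totallyBounded (1 / (2 * c)) (by positivity)
  refine ⟨hF.toFinset.card, fun r p m w hr hwp hsep => ?_⟩
  have hball : ∀ i, ∃ q ∈ F, dist (r⁻¹ • (w i - p)) q < 1 / (2 * c) := by
    intro i
    have : r⁻¹ • (w i - p) ∈ Metric.closedBall (0 : E n) 2 := by
      rw [mem_closedBall_zero_iff, norm_smul, norm_inv, Real.norm_of_nonneg hr.le, ← dist_eq_norm,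
        inv_mul_le_iff₀ hr]
      linarith [hwp i]
    simpa using hcov this
  choose q hq hqd using hball
  have hinj : Function.Injective q := by
    intro i j hij
    by_contra hne
    have h1 := hsep i j hne
    have h2 := dist_triangle_right (r⁻¹ • (w i - p)) (r⁻¹ • (w j - p)) (q i)
    have h3 := hqd i
    have h4 := hqd j
    rw [← hij] at h4
    have h5 : dist (r⁻¹ • (w i - p)) (r⁻¹ • (w j - p)) = r⁻¹ * dist (w i) (w j) := by
      rw [dist_smul₀, dist_sub_right, norm_inv, Real.norm_of_nonneg hr.le]
    have h6 : 1 / c ≤ r⁻¹ * dist (w i) (w j) := by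
      rw [inv_mul_eq_div, le_div_iff₀ hr]
      calc 1 / c * r = r / c := by ring
        _ ≤ _ := h1
    have h7 : 1 / (2 * c) + 1 / (2 * c) = 1 / c := by field_simp; norm_num
    linarith
  have := Finset.card_le_card_of_injOn (s := Finset.univ) (t := hF.toFinset) q
    (fun i _ => by simpa using hq i) hinj.injOn
  simpa using this

/-- Packing argument. If the inner distance of the ends were too large, the path would contain `N +
2` points pairwise far apart in inner length, and the points `w i` built from them would contradict
the bound `N`. -/
theorem exists_lipDist_le_mul_diam (n : ℕ) (hc : 0 < c) :
    ∃ B, 0 < B ∧ ∀ D : Set (E n), IsOpen D → (frontier D).Nonempty → IsInnerUniform D c →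
      ∀ x y : E n, ∀ β : Path x y, range β ⊆ D →
        lipDist D x y ≤ B * Metric.diam (range β) := by
  obtain ⟨N, hN⟩ := exists_card_bound_of_separated n hc
  refine ⟨(N + 1) * (2 + 1 / c), by positivity, fun D hO hF hD x y β hβ => ?_⟩
  have hconn : IsLipConnected D := fun a ha b hb => by
    obtain ⟨L, g, hg, -⟩ := hD.exists_curve ha hb
    exact ⟨L, g, hg.isLipCurve⟩
  have hβD : ∀ t, β t ∈ D := fun t => hβ ⟨t, rfl⟩
  have hbdd : Bornology.IsBounded (range β) := (isCompact_range β.continuous).isBounded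
  have hdiam : ∀ s t, dist (β s) (β t) ≤ Metric.diam (range β) := fun s t =>
    Metric.dist_le_diam_of_mem hbdd ⟨s, rfl⟩ ⟨t, rfl⟩
  have hx : x ∈ D := by have := hβD 0; rwa [β.source] at this
  set r := Metric.diam (range β) with hr
  rcases (Metric.diam_nonneg : 0 ≤ r).eq_or_lt with h0 | hrpos
  · have h1 := hdiam 0 1
    rw [β.source, β.target] at h1
    have hr0 : r = 0 := h0.symm
    rw [hr0] at h1
    rw [← dist_le_zero.1 h1, lipDist_self hx, hr0, mul_zero]
  by_contra! hlt
  have hs : 0 < (2 + 1 / c) * r := by positivity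
  have hcont : Continuous fun t => lipDist D x (β t) :=
    (continuousOn_lipDist hO hF hconn hx).comp_continuous β.continuous hβD
  have hivt : ∀ i : Fin (N + 2), ∃ t, lipDist D x (β t) = i * ((2 + 1 / c) * r) := by
    intro i
    have hi : ((i : ℕ) : ℝ) ≤ N + 1 := by exact_mod_cast Nat.lt_succ_iff.1 i.2
    have := isPreconnected_univ.intermediate_value (mem_univ (0 : unitInterval))
      (mem_univ (1 : unitInterval)) hcont.continuousOn
    rw [β.source, β.target, lipDist_self hx] at this
    have hile : (i : ℝ) * ((2 + 1 / c) * r) ≤ lipDist D x y := by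
      refine le_trans ?_ hlt.le
      rw [mul_assoc]
      exact mul_le_mul_of_nonneg_right hi hs.le
    obtain ⟨t, -, ht⟩ := this ⟨by positivity, hile⟩
    exact ⟨t, ht⟩
  choose t ht using hivt
  have hfar : ∀ i j : Fin (N + 2), i ≠ j →
      (2 + 1 / c) * r ≤ lipDist D (β (t i)) (β (t j)) := by
    intro i j hij
    refine le_trans ?_ (abs_lipDist_sub_le hconn hx (hβD (t i)) (hβD (t j)))
    rw [ht, ht, ← sub_mul, abs_mul, abs_of_pos hs]
    refine le_mul_of_one_le_left hs.le ?_
    have h1 : ((i : ℕ) : ℤ) - (j : ℕ) ≠ 0 := by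
      intro h
      exact hij (Fin.ext (by omega))
    exact_mod_cast Int.one_le_abs h1
  -- Follow an inner uniform curve towards another chosen point for length `r`; it is at least `2r`
  -- long, so the cigar condition there gives boundary distance at least `r / c`.
  have hw : ∀ i : Fin (N + 2), ∃ w ∈ D, lipDist D (β (t i)) w ≤ r ∧ dist (β (t i)) w ≤ r ∧
      r / c ≤ bdryDist D w := by
    intro i
    obtain ⟨j, hj⟩ := exists_ne i
    obtain ⟨L, g, hg, hmin, -⟩ := hD.exists_curve (hβD (t i)) (hβD (t j))
    have h1 := (hfar i j hj.symm).trans hg.isLipCurve.lipDist_le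
    have h2 : 0 < 1 / c * r := by positivity
    have hrL : r ∈ Icc 0 L := ⟨hrpos.le, by nlinarith⟩
    have h3 := hg.isLipCurve.restrict le_rfl hrL.1 hrL.2
    rw [hg.left, sub_zero] at h3
    have h4 := hmin r hrL
    rw [min_eq_left (by linarith)] at h4
    exact ⟨g r, hg.mem r hrL, h3.lipDist_le, h3.dist_le, (div_le_iff₀' hc).2 h4⟩
  choose w hwD hw1 hw2 hw3 using hw
  have := hN r x (N + 2) w hrpos (fun i => ?_) fun i j hij => ?_
  · omega
  · have h1 := dist_triangle_left (w i) x (β (t i))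
    have h2 := hdiam (t i) 0
    rw [β.source] at h2
    linarith [hw2 i]
  · by_contra! hlt'
    -- If `w j` were within `r / c` of `w i`, the segment between them would lie in `D`, giving a
    -- route between the original points shorter than `2r + r / c`.
    have h1 := lipDist_le_dist hO (hwD i) (hlt'.trans_le (hw3 i))
    have h2 := lipDist_triangle hconn (hβD (t i)) (hwD i) (hβD (t j))
    have h3 := lipDist_triangle hconn (hwD i) (hwD j) (hβD (t j))
    rw [lipDist_comm D (w j)] at h3
    have h4 := hfar i j hij
    have h5 : (2 + 1 / c) * r = 2 * r + r / c := by ring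
    linarith [hw1 i, hw1 j]

theorem isAUniform_of_isInnerUniform {μ : ℝ} (hn : 2 ≤ n) (hc : 0 < c) (hμ : 0 < μ) :
    ∃ K : ℝ, 0 < K ∧ ∀ D : Set (E n), IsApollonianDomain D → IsInnerUniform D c →
      (∀ x ∈ D, ∀ y ∈ D, jPrime D x y ≤ μ * apollonianDist D x y) → IsAUniform D K := by
  obtain ⟨B, hB, hBD⟩ := exists_lipDist_le_mul_diam n hc
  -- The maximum with 1 is what `log_one_add_mul_le` requires.
  have hA : 1 ≤ max 1 (c * B) := le_max_left _ _
  have hA0 : 0 < max 1 (c * B) := by linarith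
  refine ⟨2 * (2 * c + 1) * max 1 (c * B) * μ, by positivity, fun D hD hU hj x hx y hy => ?_⟩
  have hO := hD.isOpen
  have hF := hD.frontier_nonempty hn
  obtain ⟨L, g, hg, hmin, hlen⟩ := hU.exists_curve hx hy
  have hconn : IsLipConnected D := fun a ha b hb => by
    obtain ⟨L, g, hg, -⟩ := hU.exists_curve ha hb
    exact ⟨L, g, hg.isLipCurve⟩
  have hL1 : L ≤ c * lipDist D x y := by
    rw [← div_le_iff₀' hc]
    refine le_lipDist hconn hx hy fun M h hh => ?_
    rw [div_le_iff₀' hc]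
    exact hlen M h hh
  have hρ : L ≤ max 1 (c * B) * innerDiamDist D x y := by
    rw [← div_le_iff₀' hA0]
    obtain ⟨γ, hγ1, hγ2, -⟩ := hU.2 x hx y hy
    refine le_csInf ⟨_, γ, hγ1, hγ2, rfl⟩ ?_
    rintro _ ⟨β, -, hβ, rfl⟩
    rw [div_le_iff₀' hA0]
    calc L ≤ c * lipDist D x y := hL1
      _ ≤ c * (B * Metric.diam (range β)) :=
        mul_le_mul_of_nonneg_left (hBD D hO hF hU x y β hβ) hc.le
      _ = c * B * Metric.diam (range β) := by ring
      _ ≤ _ := mul_le_mul_of_nonneg_right (le_max_right _ _) Metric.diam_nonneg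
  have hρ0 : 0 ≤ innerDiamDist D x y := by
    by_contra! hneg
    nlinarith [hg.nonneg]
  have hm : 0 < min (bdryDist D x) (bdryDist D y) :=
    lt_min (bdryDist_pos hO hF hx) (bdryDist_pos hO hF hy)
  have h1 := (hg.isLipCurve.isLipWeight hO hF).integral_le_log hc hmin
  simp only [hg.left, hg.right] at h1
  have h2 : Real.log (1 + L / min (bdryDist D x) (bdryDist D y)) ≤
      max 1 (c * B) * jPrime D x y := by
    refine le_trans ?_ (log_one_add_mul_le hA (div_nonneg hρ0 hm.le))
    have h3 : 0 ≤ L / min (bdryDist D x) (bdryDist D y) := div_nonneg hg.nonneg hm.le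
    refine Real.log_le_log (by linarith) ?_
    rw [← mul_div_assoc]
    gcongr
  have hc' : 0 ≤ 2 * (2 * c + 1) := by linarith
  calc quasihyperbolicDist D x y ≤ _ := quasihyperbolicDist_le hg
    _ ≤ _ := h1
    _ ≤ 2 * (2 * c + 1) * (max 1 (c * B) * (μ * apollonianDist D x y)) :=
      mul_le_mul_of_nonneg_left (h2.trans
        (mul_le_mul_of_nonneg_left (hj x hx y hy) hA0.le)) hc'
    _ = _ := by ring

end

end ApollonianGeom

theorem corollary1p2 (n : ℕ) (hn : 2 ≤ n) :
    (∀ K : ℝ, 0 < K → ∃ c μ₅ : ℝ, 0 < c ∧ 0 < μ₅ ∧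
      ∀ D : Set (ApollonianGeom.E n), ApollonianGeom.IsApollonianDomain D →
        ApollonianGeom.IsAUniform D K →
          ApollonianGeom.IsInnerUniform D c ∧
          ∀ x ∈ D, ∀ y ∈ D,
            ApollonianGeom.jPrime D x y ≤ μ₅ * ApollonianGeom.apollonianDist D x y) ∧
    (∀ c μ₅ : ℝ, 0 < c → 0 < μ₅ → ∃ K : ℝ, 0 < K ∧
      ∀ D : Set (ApollonianGeom.E n), ApollonianGeom.IsApollonianDomain D →
        (ApollonianGeom.IsInnerUniform D c ∧
          ∀ x ∈ D, ∀ y ∈ D,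
            ApollonianGeom.jPrime D x y ≤ μ₅ * ApollonianGeom.apollonianDist D x y) →
          ApollonianGeom.IsAUniform D K) := by
  refine ⟨fun K hK => ApollonianGeom.isInnerUniform_and_jPrime_le_of_isAUniform hn hK,
    fun c μ hc hμ => ?_⟩
  obtain ⟨K, hK, h⟩ := ApollonianGeom.isAUniform_of_isInnerUniform hn hc hμ
  exact ⟨K, hK, fun D hD h2 => h D hD h2.1 h2.2⟩
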